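/- Let $\Omega\subset\mathbb R$ be a set of directions (angles) and let $k\in\mathbb N$. Let $\mathcal B_{\Omega,k}$ be the collection of all convex polygons $B\subset[0,1]^2$ with at most $k$ sides, all of whose normals are of the form $\pm(\cos\theta,\sin\theta)$ with $\theta\in\Omega$. For $N\ge 1$ put $$D_{\Omega,k}(N)=\inf_{\substack{\mathcal P\subset[0,1]^2\\ \#\mathcal P=N}}\ \sup_{B\in\mathcal B_{\Omega,k}}\Big|\#(\mathcal P\cap B)-N\,|B|\Big| .$$ Write $\log N$ for $\max\{1,\log_2N\}$. A sequence $(u_n)$ is lacunary with limit $a$ and ratio $A\in(0,1)$ if $u_n\ne a$ and $|u_{n+1}-a|<A|u_n-a|$ for all $n$. A set is lacunary of order $1$ with ratio $A$ if it is contained in a lacunary sequence with ratio $A$. A set $\Omega$ is lacunary of order $M+1$ with ratio $A$ if there are a set $\Omega'$ that is lacunary of order $M$ with ratio $A$ and, for each $a\in\overline{\Omega'}$, two lacunary sequences with limit $a$ and the same ratio $A$, such that every $x\in\Omega\setminus\Omega'$ is a term of one of the sequences of some $a\in\overline{\Omega'}$ for which no point of $\Omega'$ lies strictly between $a$ and $x$.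 A set is lacunary of order $M$ if it is so with some ratio $A\in(0,1)$. The upper Minkowski dimension of $\Omega$ is the infimum of the $s\ge0$ such that for all sufficiently small $\delta>0$ the set $\Omega$ can be covered by $O(\delta^{-s})$ intervals of length $\delta$. 1) If $\Omega$ is a finite union of lacunary sets of order at most $M$, where $M\ge1$, then there is a constant $C$, depending on $\Omega$, $M$ and $k$ but not on $N$, such that for all $N\ge1$ $$D_{\Omega,k}(N)\le C\,\log^{2M+1}N .$$ 2) If $\Omega$ has upper Minkowski dimension $d$ with $0\le d<1$, and $\tau=\frac{2}{(1-d)^2}-2$, then for every $\varepsilon>0$ there is a constant $C$, depending on $\Omega$, $k$ and $\varepsilon$ but not on $N$, such that for all $N\ge1$ $$D_{\Omega,k}(N)\le C\,N^{\frac{\tau}{2(\tau+1)}+\varepsilon}.$$ -/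

import Mathlib

open MeasureTheory Set
open scoped ENNReal

namespace DirectionalDiscrepancy

/-- The unit square `[0,1]²` in the plane. -/
def unitSquare : Set (ℝ × ℝ) := Icc 0 1 ×ˢ Icc 0 1

/-- The unit vector that makes the angle `θ` with the `x`-axis. -/
noncomputable def dir (θ : ℝ) : ℝ × ℝ := (Real.cos θ, Real.sin θ)

/-- The closed half-plane `{p : ⟨ν, p⟩ ≤ c}` with outer normal `ν`. -/
def halfPlane (ν : ℝ × ℝ) (c : ℝ) : Set (ℝ × ℝ) := {p | ν.1 * p.1 + ν.2 * p.2 ≤ c}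

/-- The (closed, non-degenerate) convex polygons in `[0,1]²` with at most `k` sides, all of whose
normals are of the form `± dir θ` with `θ ∈ Ω`; a polygon is described as the intersection of the
half-planes that its sides span. -/
def convexPolygons (Ω : Set ℝ) (k : ℕ) : Set (Set (ℝ × ℝ)) :=
  {B | B ⊆ unitSquare ∧ (interior B).Nonempty ∧
    ∃ m ≤ k, ∃ (ν : Fin m → ℝ × ℝ) (c : Fin m → ℝ),
      (∀ i, ∃ θ ∈ Ω, ν i = dir θ ∨ ν i = -dir θ) ∧ B = ⋂ i, halfPlane (ν i) (c i)}

/-- `inf` over `N`-point sets `P ⊆ [0,1]²` of the `sup` over the polygons `B` of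
`|#(P ∩ B) - N |B||`. -/
noncomputable def discrepancy (Ω : Set ℝ) (k N : ℕ) : ℝ≥0∞ :=
  ⨅ (P : Finset (ℝ × ℝ)) (_ : (P : Set (ℝ × ℝ)) ⊆ unitSquare) (_ : P.card = N),
    ⨆ B ∈ convexPolygons Ω k,
      ENNReal.ofReal |(((P : Set (ℝ × ℝ)) ∩ B).ncard : ℝ) - N * volume.real B|

/-- `u` is a lacunary sequence with limit `a` and ratio `A` (to be used with `0 < A < 1`). -/
def IsLacunarySeq (A a : ℝ) (u : ℕ → ℝ) : Prop :=
  ∀ n, u n ≠ a ∧ |u (n + 1) - a| < A * |u n - a|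

/-- `Ω` is a lacunary set of order `M ≥ 1` with ratio `A`.
Order one: (part of) a lacunary sequence.  Order `M + 1`: `Ω` is covered by a lacunary set `Ω'` of
order `M` together with lacunary sequences `l a`, `r a` converging to the points `a` of the closure
of `Ω'`.  The ratio is the same for all these sequences, and the sequences that converge to `a` are
used only inside the complementary intervals of `Ω'` adjacent to `a`, that is, at points `x` such
that no point of `Ω'` lies strictly between `a` and `x`. -/
inductive IsLacunaryOfOrder (A : ℝ) : ℕ → Set ℝ → Prop
  | one {Ω : Set ℝ} (a : ℝ) (u : ℕ → ℝ) (hu : IsLacunarySeq A a u) (hΩ : Ω ⊆ range u) :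
      IsLacunaryOfOrder A 1 Ω
  | succ {M : ℕ} {Ω Ω' : Set ℝ} (h' : IsLacunaryOfOrder A M Ω') (l r : ℝ → ℕ → ℝ)
      (hl : ∀ a ∈ closure Ω', IsLacunarySeq A a (l a))
      (hr : ∀ a ∈ closure Ω', IsLacunarySeq A a (r a))
      (hΩ : ∀ x ∈ Ω, x ∈ Ω' ∨ ∃ a ∈ closure Ω',
        Disjoint (openSegment ℝ a x) Ω' ∧ (x ∈ range (l a) ∨ x ∈ range (r a))) :
      IsLacunaryOfOrder A (M + 1) Ω

/-- `Ω` is a finite union of lacunary sets of order at most `M`. -/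
def IsFiniteUnionLacunary (M : ℕ) (Ω : Set ℝ) : Prop :=
  ∃ S : Set (Set ℝ), S.Finite ∧ Ω = ⋃₀ S ∧
    ∀ T ∈ S, ∃ (m : ℕ) (A : ℝ), 1 ≤ m ∧ m ≤ M ∧ 0 < A ∧ A < 1 ∧ IsLacunaryOfOrder A m T

/-- For all small `δ > 0`, `Ω` is covered by `O(δ ^ (-s))` intervals of length `δ`. -/
def HasCoveringExponent (Ω : Set ℝ) (s : ℝ) : Prop :=
  ∃ C > (0 : ℝ), ∃ δ₀ > (0 : ℝ), ∀ δ : ℝ, 0 < δ → δ < δ₀ →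
    ∃ t : Finset ℝ, (t.card : ℝ) ≤ C * δ ^ (-s) ∧ Ω ⊆ ⋃ a ∈ t, Icc a (a + δ)

/-- `Ω` has upper Minkowski dimension `d`: the infimum of the covering exponents exists and is `d`
(the empty set has dimension `0`). -/
def HasUpperMinkowskiDim (Ω : Set ℝ) (d : ℝ) : Prop :=
  IsGLB {s : ℝ | 0 ≤ s ∧ HasCoveringExponent Ω s} d

/-- The convention `log n = max {1, log₂ n}`. -/
noncomputable def log' (n : ℕ) : ℝ := max 1 (Real.logb 2 n)

end DirectionalDiscrepancy

namespace DirectionalDiscrepancy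

/-! The points come from one lattice of density `N`: `ℤ²` is sheared by `β`, rotated by `φ` and
shrunk by `√N`, and its part in the unit square is then trimmed or filled up to exactly `N` points.
The angle `φ` is chosen so that all lines with normals in `Ω` have bounded slope in the rotated
coordinates. This is possible because `Ω` has a covering exponent below one
(`exists_transversal_direction`).

Pulled back to `ℤ²`, a polygon is the region between the graphs of two concave, piecewise affine
functions. A column of height `F + G` contains exactly `F + G - saw F - saw G` integer points.
Summing the heights over the columns gives the area up to a multiple of the Lipschitz constant
(`abs_sum_sub_integral_posPart_le`). What remains is a bounded number of sums of `saw (s * n + t)`,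
one for each side (`abs_sum_saw_minAffine_le`). If `s` is badly approximable with constant `K` up to
the scale `Q ≈ √N`, such a sum is `O(K log N)` (`abs_sum_saw_le`).

The shear replaces every slope `s` by `s - β`. For a single slope, the `β ∈ [0,1]` that violate bad
approximability with constant `K` form a set of measure `O(log N / K)`. So one `β` serves `n` slopes
at once as soon as `K` exceeds a multiple of `n log N`. If `δ * N ≤ K`, a slope at distance `O(δ)`
from a treated one is also badly approximable, so one representative for each interval of a
`δ`-cover is enough (`exists_shear`). With `n` intervals of length `δ` covering `Ω`, the discrepancy
is therefore `O((n log N + δ N) log N)` (`exists_discrepancy_le_of_covering`).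

A lacunary set of order `M` is covered by `O(log^M (1/δ))` intervals, because each interval in a
cover of the lower-order set gives rise to at most four sequences that matter. Taking `δ = 1/N`
yields `log^(M+2) N`. In dimension `d`, balancing the two terms yields `N^(d/(1+d)+ε)`. Both bounds
imply the required ones. -/

/-! ### Sawtooth sums along arithmetic progressions -/

/-- The sawtooth function. -/
noncomputable def saw (x : ℝ) : ℝ := Int.fract x - 1 / 2

/-- A shift by `w ∈ [-1, 2]` can carry `j / q` past an integer only from `j = 0` or from `j ≥ q -
2`. There the trivial bound `1` is used. -/
theorem abs_fract_div_sub_le {q j : ℕ} {w : ℝ} (hj : j < q) (hw : -1 ≤ w) (hw' : w ≤ 2) :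
    |Int.fract (((j : ℝ) + w) / q) - j / q| ≤
      2 / q + if j = 0 ∨ q ≤ j + 2 then (1 : ℝ) else 0 := by
  have hq : (0 : ℝ) < q := by exact_mod_cast (Nat.zero_le j).trans_lt hj
  split_ifs with h
  · have h1 := Int.fract_nonneg (((j : ℝ) + w) / q)
    have h2 := Int.fract_lt_one (((j : ℝ) + w) / q)
    have h3 : (0 : ℝ) ≤ j / q := by positivity
    have h4 : (j : ℝ) / q ≤ 1 := by
      rw [div_le_one hq]; exact_mod_cast hj.le
    have h5 : (0 : ℝ) ≤ 2 / q := by positivity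
    rw [abs_le]; constructor <;> linarith
  · push Not at h
    have hj1 : (1 : ℝ) ≤ j := by exact_mod_cast Nat.one_le_iff_ne_zero.mpr h.1
    have hj2 : (j : ℝ) + 2 < q := by exact_mod_cast h.2
    have : Int.fract (((j : ℝ) + w) / q) = ((j : ℝ) + w) / q := by
      rw [Int.fract_eq_self]
      refine ⟨div_nonneg (by linarith) hq.le, ?_⟩
      rw [div_lt_one hq]; linarith
    rw [this, add_div, add_sub_cancel_left, abs_div, abs_of_pos hq, add_zero]
    gcongr
    rw [abs_le]; constructor <;> linarith

theorem sum_comp_mul_add_emod {q : ℕ} (hq : 0 < q) {p : ℤ} (hp : IsCoprime p q) (r : ℤ)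
    (f : ℕ → ℝ) :
    ∑ n ∈ Finset.range q, f (((p * n + r) % q).toNat) = ∑ j ∈ Finset.range q, f j := by
  have hq0 : (0 : ℤ) < q := by exact_mod_cast hq
  have hmaps : ∀ n ∈ Finset.range q, ((p * n + r) % q).toNat ∈ Finset.range q := by
    intro n _
    rw [Finset.mem_range]
    have h1 := Int.emod_nonneg (p * n + r) hq0.ne'
    have h2 := Int.emod_lt_of_pos (p * n + r) hq0
    omega
  have hinj : Set.InjOn (fun n : ℕ => ((p * n + r) % q).toNat) (Finset.range q : Set ℕ) := by
    intro a ha b hb hab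
    simp only [Finset.coe_range, Set.mem_Iio] at ha hb
    have h1 := Int.emod_nonneg (p * a + r) hq0.ne'
    have h2 := Int.emod_nonneg (p * b + r) hq0.ne'
    have h3 : (p * a + r) % q = (p * b + r) % q := by
      simp only at hab
      omega
    have h4 : (q : ℤ) ∣ p * ((a : ℤ) - b) := by
      have h6 := Int.ModEq.dvd (show p * b + r ≡ p * a + r [ZMOD q] from h3.symm)
      convert h6 using 1
      ring
    have h5 : (q : ℤ) ∣ (a : ℤ) - b := hp.symm.dvd_of_dvd_mul_left h4
    obtain ⟨c, hc⟩ := h5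
    have : c = 0 := by
      by_contra hc0
      rcases lt_or_gt_of_ne hc0 with h | h <;> nlinarith
    subst this
    omega
  exact Finset.sum_nbij _ hmaps hinj
    (Finset.surjOn_of_injOn_of_card_le _ hmaps hinj le_rfl) (fun _ _ => rfl)

theorem sum_exceptional_le (q : ℕ) :
    ∑ j ∈ Finset.range q, (if j = 0 ∨ q ≤ j + 2 then (1 : ℝ) else 0) ≤ 3 := by
  rw [Finset.sum_boole]
  have : (Finset.range q).filter (fun j => j = 0 ∨ q ≤ j + 2) ⊆ {0, q - 1, q - 2} := by
    intro j
    simp only [Finset.mem_filter, Finset.mem_range, Finset.mem_insert, Finset.mem_singleton]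
    omega
  exact_mod_cast (Finset.card_le_card this).trans Finset.card_le_three

/-- The sum of the sawtooth function over a full period of a rational approximation. -/
theorem abs_sum_saw_period_le {q : ℕ} (hq : 0 < q) {p : ℤ} (hp : IsCoprime p q) {s : ℝ}
    (hs : |q * s - p| ≤ 1 / q) (t : ℝ) :
    |∑ n ∈ Finset.range q, saw (s * n + t)| ≤ 6 := by
  have hq0 : (0 : ℝ) < q := by exact_mod_cast hq
  have hqz : (0 : ℤ) < q := by exact_mod_cast hq
  set r : ℤ := ⌊q * t⌋ with hr
  set j : ℕ → ℕ := fun n => ((p * n + r) % q).toNat with hj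
  have key : ∀ n ∈ Finset.range q, |Int.fract (s * n + t) - (j n : ℝ) / q| ≤
      2 / q + if j n = 0 ∨ q ≤ j n + 2 then (1 : ℝ) else 0 := by
    intro n hn
    have hn' : (n : ℝ) < q := by exact_mod_cast Finset.mem_range.mp hn
    have hn0 : (0 : ℝ) ≤ n := n.cast_nonneg
    have h1 := Int.emod_nonneg (p * n + r) hqz.ne'
    have h2 := Int.emod_lt_of_pos (p * n + r) hqz
    have hjn : ((j n : ℕ) : ℤ) = (p * n + r) % q := by simp only [hj]; omega
    have hjq : j n < q := by omega
    -- Modulo `q`, the number `q * (s * n + t)` is the residue `j n` displaced by `w`. The first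
    -- summand is at most `1` in absolute value since `n < q`.
    set w : ℝ := n * (q * s - p) + Int.fract (q * t) with hw
    have hwabs : |(n : ℝ) * (q * s - p)| ≤ 1 := by
      rw [abs_mul, abs_of_nonneg hn0]
      calc (n : ℝ) * |q * s - p| ≤ q * (1 / q) := by gcongr
        _ = 1 := by field_simp
    have hf0 := Int.fract_nonneg ((q : ℝ) * t)
    have hf1 := Int.fract_lt_one ((q : ℝ) * t)
    have hdiv : ((p * n + r : ℤ) : ℝ) = q * (((p * n + r) / q : ℤ) : ℝ) + j n := by
      have := Int.mul_ediv_add_emod (p * n + r) q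
      rw [← hjn] at this
      exact_mod_cast this.symm
    have heq : s * n + t = ((j n : ℝ) + w) / q + (((p * n + r) / q : ℤ) : ℝ) := by
      have hfl : (r : ℝ) + Int.fract (q * t) = q * t := by rw [hr]; exact Int.floor_add_fract _
      push_cast at hdiv
      field_simp
      rw [hw]
      linear_combination (-1 : ℝ) * hfl + hdiv
    rw [heq, Int.fract_add_intCast]
    rw [abs_le] at hwabs
    exact abs_fract_div_sub_le hjq (by rw [hw]; linarith) (by rw [hw]; linarith)
  have hsum : ∑ n ∈ Finset.range q, saw (s * n + t) =
      ∑ n ∈ Finset.range q, (Int.fract (s * n + t) - (j n : ℝ) / q) - 1 / 2 := by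
    have e1 : ∑ n ∈ Finset.range q, (j n : ℝ) / q = ((q : ℝ) - 1) / 2 := by
      rw [sum_comp_mul_add_emod hq hp r (fun m => (m : ℝ) / q), ← Finset.sum_div]
      have := Finset.sum_range_id_mul_two q
      have h' : (∑ i ∈ Finset.range q, (i : ℝ)) * 2 = q * (q - 1) := by
        have h2 : (((∑ i ∈ Finset.range q, i) * 2 : ℕ) : ℝ) = ((q * (q - 1) : ℕ) : ℝ) := by
          rw [this]
        rw [Nat.cast_mul, Nat.cast_mul, Nat.cast_sub hq] at h2
        push_cast at h2
        exact h2
      field_simp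
      linarith
    simp only [saw, Finset.sum_sub_distrib, e1, Finset.sum_const, Finset.card_range, nsmul_eq_mul]
    ring
  have hb : |∑ n ∈ Finset.range q, (Int.fract (s * n + t) - (j n : ℝ) / q)| ≤ 5 := by
    calc _ ≤ ∑ n ∈ Finset.range q, |Int.fract (s * n + t) - (j n : ℝ) / q| :=
          Finset.abs_sum_le_sum_abs _ _
      _ ≤ ∑ n ∈ Finset.range q, (2 / q + if j n = 0 ∨ q ≤ j n + 2 then (1 : ℝ) else 0) :=
          Finset.sum_le_sum key
      _ = ∑ m ∈ Finset.range q, (2 / q + if m = 0 ∨ q ≤ m + 2 then (1 : ℝ) else 0) :=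
          sum_comp_mul_add_emod hq hp r
            (fun m => 2 / (q : ℝ) + if m = 0 ∨ q ≤ m + 2 then (1 : ℝ) else 0)
      _ ≤ 2 + 3 := by
          rw [Finset.sum_add_distrib]
          refine add_le_add ?_ (sum_exceptional_le q)
          simp only [Finset.sum_const, Finset.card_range, nsmul_eq_mul]
          field_simp
          exact le_rfl
      _ = 5 := by norm_num
  rw [hsum]
  rw [abs_le] at hb ⊢
  constructor <;> linarith

/-- `s` is not too well approximable by rationals with denominators up to `Q / K`. -/
def IsBadlyApproximable (K : ℝ) (Q : ℕ) (s : ℝ) : Prop :=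
  ∀ q : ℕ, 1 ≤ q → q * K ≤ Q → ∀ p : ℤ, 1 / (K * q) ≤ |q * s - p|

theorem IsBadlyApproximable.neg {K : ℝ} {Q : ℕ} {s : ℝ} (h : IsBadlyApproximable K Q s) :
    IsBadlyApproximable K Q (-s) := by
  intro q hq hqK p
  have := h q hq hqK (-p)
  rw [← abs_neg] at this
  convert this using 2
  push_cast
  ring

/-- Dirichlet's theorem supplies a denominator `q ≤ l`, and bad approximability forces `l ≤ K * q`.
The sum then consists of at most `K` full periods, each bounded by `6`, and a remainder of length at
most `l / 2`. The recursion depth is the number of binary digits of `l`. -/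
theorem abs_sum_saw_le {K : ℝ} (hK : 0 < K) {Q : ℕ} {s : ℝ} (hs : IsBadlyApproximable K Q s)
    (l : ℕ) : l ≤ Q → ∀ t : ℝ, |∑ n ∈ Finset.range l, saw (s * n + t)| ≤ 6 * K * Nat.size l := by
  induction l using Nat.strong_induction_on with
  | _ l ih =>
    intro hlQ t
    rcases Nat.eq_zero_or_pos l with rfl | hl
    · simp
    obtain ⟨x, hx, hxl⟩ := Real.exists_rat_abs_sub_le_and_den_le s hl
    set q := x.den with hqdef
    have hq : 0 < q := x.den_pos
    have hq0 : (0 : ℝ) < q := by exact_mod_cast hq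
    have hl0 : (0 : ℝ) < l := by exact_mod_cast hl
    have hcop : IsCoprime x.num (q : ℤ) := by
      rw [Int.isCoprime_iff_gcd_eq_one]
      exact x.reduced
    have hqx : |q * s - x.num| ≤ 1 / (l + 1) := by
      have h1 : (q : ℝ) * s - x.num = q * (s - x) := by
        have : (x : ℝ) = x.num / q := Rat.cast_def x
        rw [this]; field_simp
      rw [h1, abs_mul, abs_of_pos hq0]
      calc (q : ℝ) * |s - x| ≤ q * (1 / ((l + 1) * q)) := by gcongr
        _ = 1 / (l + 1) := by field_simp
    have hlq : (l : ℝ) ≤ K * q := by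
      by_cases h : q * K ≤ Q
      · have h2 := (hs q hq h x.num).trans hqx
        rw [one_div_le_one_div (by positivity) (by positivity)] at h2
        linarith
      · push Not at h
        have : (l : ℝ) ≤ Q := by exact_mod_cast hlQ
        linarith
    have hq1 : |q * s - x.num| ≤ 1 / q := by
      refine hqx.trans ?_
      have : (q : ℝ) ≤ l := by exact_mod_cast hxl
      gcongr
      linarith
    have hblocks : ∀ b : ℕ, |∑ n ∈ Finset.range (q * b), saw (s * n + t)| ≤ 6 * b := by
      intro b
      induction b with
      | zero => simp
      | succ b ihb =>
        rw [Nat.mul_succ, Finset.sum_range_add]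
        have := abs_sum_saw_period_le hq hcop hq1 (s * (q * b : ℕ) + t)
        have e : ∀ n : ℕ, s * n + (s * (q * b : ℕ) + t) = s * ((q * b + n : ℕ) : ℝ) + t := by
          intro n; push_cast; ring
        simp only [e] at this
        push_cast
        push_cast at this ihb
        exact (abs_add_le _ _).trans (by linarith)
    have hrem : l % q < l := by
      exact (Nat.mod_lt l hq).trans_le hxl
    -- As `q ≤ l`, the remainder is at most `l / 2`, so it has one binary digit less. That digit
    -- pays the cost `6 * K` of the full periods.
    have hsize : Nat.size (l % q) + 1 ≤ Nat.size l := by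
      have h2 : 2 * (l % q) ≤ l := by
        have := Nat.div_add_mod l q
        have h3 := Nat.mod_lt l hq
        have h4 : 1 ≤ l / q := Nat.div_pos hxl hq
        nlinarith
      by_contra hcon
      have h5 : Nat.size l ≤ Nat.size (l % q) := by omega
      have h6 : l % q ≤ l / 2 := by omega
      have h7 : Nat.size (l % q) ≤ Nat.size l - 1 := by
        rw [Nat.size_le]
        have h8 := Nat.lt_size_self l
        have h9 : 0 < Nat.size l := Nat.size_pos.mpr hl
        obtain ⟨m, hm⟩ : ∃ m, Nat.size l = m + 1 := ⟨Nat.size l - 1, by omega⟩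
        rw [hm, pow_succ] at h8
        rw [hm, Nat.add_sub_cancel]
        omega
      have h9 : 0 < Nat.size l := Nat.size_pos.mpr hl
      omega
    have hr := ih (l % q) hrem (hrem.le.trans hlQ) (s * (q * (l / q) : ℕ) + t)
    have e : ∀ n : ℕ, s * n + (s * (q * (l / q) : ℕ) + t) =
        s * ((q * (l / q) + n : ℕ) : ℝ) + t := by
      intro n; push_cast; ring
    simp only [e] at hr
    have hb := hblocks (l / q)
    have hsplit : ∑ n ∈ Finset.range l, saw (s * n + t) =
        ∑ n ∈ Finset.range (q * (l / q)), saw (s * n + t) +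
        ∑ n ∈ Finset.range (l % q), saw (s * ((q * (l / q) + n : ℕ) : ℝ) + t) := by
      rw [← Finset.sum_range_add (fun n : ℕ => saw (s * n + t)), Nat.div_add_mod]
    rw [hsplit]
    have hdiv : ((l / q : ℕ) : ℝ) ≤ K := by
      refine Nat.cast_div_le.trans ?_
      rw [div_le_iff₀ hq0]; exact hlq
    have hsz : ((Nat.size (l % q) : ℕ) : ℝ) + 1 ≤ Nat.size l := by exact_mod_cast hsize
    calc _ ≤ 6 * ((l / q : ℕ) : ℝ) + 6 * K * Nat.size (l % q) :=
          (abs_add_le _ _).trans (add_le_add hb hr)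
      _ ≤ 6 * K * Nat.size l := by nlinarith

/-! ### Sums and integrals of concave functions -/

theorem exists_range_of_ordConnected {J : Finset ℤ} (hJ : (J : Set ℤ).OrdConnected)
    (hne : J.Nonempty) :
    ∃ (p : ℤ) (l : ℕ), (∀ n, n ∈ J ↔ p ≤ n ∧ n ≤ p + l) ∧ J.card = l + 1 ∧
      ∀ f : ℤ → ℝ, ∑ n ∈ J, f n = ∑ i ∈ Finset.range (l + 1), f (p + i) := by
  have hmm := J.min'_le _ (J.max'_mem hne)
  have hiff : ∀ n, n ∈ J ↔ J.min' hne ≤ n ∧ n ≤ J.min' hne + ((J.max' hne - J.min' hne).toNat : ℕ) := by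
    intro n
    rw [Int.toNat_of_nonneg (by linarith), add_sub_cancel]
    exact ⟨fun h => ⟨J.min'_le _ h, J.le_max' _ h⟩,
      fun h => hJ.out (J.min'_mem hne) (J.max'_mem hne) h⟩
  set p := J.min' hne
  set l := (J.max' hne - p).toNat
  have hmap : J = (Finset.range (l + 1)).image (fun i : ℕ => p + i) := by
    ext n
    rw [hiff, Finset.mem_image]
    constructor
    · rintro ⟨h1, h2⟩
      exact ⟨(n - p).toNat, by rw [Finset.mem_range]; omega, by omega⟩
    · rintro ⟨i, hi, rfl⟩
      rw [Finset.mem_range] at hi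
      omega
  have hinj : Function.Injective (fun i : ℕ => p + (i : ℤ)) := fun a b h => by
    simpa using h
  refine ⟨p, l, hiff, ?_, fun f => ?_⟩
  · rw [hmap, Finset.card_image_of_injective _ hinj, Finset.card_range]
  · rw [hmap, Finset.sum_image (fun a _ b _ h => hinj h)]

theorem integral_affine_unit (a b c : ℝ) : ∫ x in c..c + 1, (a + (x - c) * b) = a + b / 2 := by
  rw [intervalIntegral.integral_add (by simp) (Continuous.intervalIntegrable (by fun_prop) _ _),
    intervalIntegral.integral_mul_const, intervalIntegral.integral_sub (by simp) (by simp)]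
  simp
  ring

theorem concave_upper {f : ℝ → ℝ} (hc : ConcaveOn ℝ univ f) {c x : ℝ} (hx : x ∈ Icc c (c + 1)) :
    f x ≤ f c + (x - c) * (f c - f (c - 1)) := by
  rcases hx.1.eq_or_lt with rfl | h
  · simp
  have := hc.slope_anti_adjacent (mem_univ (c - 1)) (mem_univ x) (by linarith : c - 1 < c) h
  rw [sub_sub_cancel, div_one, div_le_iff₀ (by linarith)] at this
  linarith

theorem concave_lower {f : ℝ → ℝ} (hc : ConcaveOn ℝ univ f) {c x : ℝ} (hx : x ∈ Icc c (c + 1)) :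
    f c + (x - c) * (f (c + 1) - f c) ≤ f x := by
  have := hc.2 (mem_univ c) (mem_univ (c + 1)) (by linarith [hx.2] : 0 ≤ c + 1 - x)
    (by linarith [hx.1] : 0 ≤ x - c) (by ring)
  simp only [smul_eq_mul] at this
  have e : (c + 1 - x) * c + (x - c) * (c + 1) = x := by ring
  rw [e] at this
  linarith

theorem concave_nonpos_left {f : ℝ → ℝ} (hc : ConcaveOn ℝ univ f) {a b x : ℝ} (ha : f a < 0)
    (hb : 0 ≤ f b) (hab : a ≤ b)
    (hx : x ≤ a) : f x ≤ 0 := by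
  by_contra h
  push Not at h
  have := hc.min_le_of_mem_Icc (mem_univ x) (mem_univ b) ⟨hx, hab⟩
  have h2 := le_min h.le hb
  linarith

theorem concave_nonpos_right {f : ℝ → ℝ} (hc : ConcaveOn ℝ univ f) {a b x : ℝ} (ha : f a < 0)
    (hb : 0 ≤ f b) (hab : b ≤ a) (hx : a ≤ x) : f x ≤ 0 := by
  by_contra h
  push Not at h
  have := hc.min_le_of_mem_Icc (mem_univ b) (mem_univ x) ⟨hab, hx⟩
  have h2 := le_min hb h.le
  linarith

theorem integral_posPart_eq {f : ℝ → ℝ} {a b : ℝ}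
    (ha : ∀ x ≤ a, f x ≤ 0) (hb : ∀ x, b ≤ x → f x ≤ 0) :
    ∫ x, max (f x) 0 = ∫ x in a..b, max (f x) 0 := by
  symm
  apply intervalIntegral.integral_eq_integral_of_support_subset
  intro x hx
  by_contra hcon
  apply hx
  simp only [max_eq_right_iff]
  by_cases h : x ≤ a
  · exact ha x h
  · push Not at h
    exact hb x (by by_contra h2; push Not at h2; exact hcon ⟨h, h2.le⟩)

theorem integral_unit_mem {g : ℝ → ℝ} (hg : Continuous g) {c L : ℝ}
    (h : ∀ x ∈ Icc c (c + 1), 0 ≤ g x ∧ g x ≤ L) :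
    0 ≤ ∫ x in c..c + 1, g x ∧ ∫ x in c..c + 1, g x ≤ L := by
  have hle : c ≤ c + 1 := by linarith
  refine ⟨intervalIntegral.integral_nonneg hle fun x hx => (h x hx).1, ?_⟩
  calc _ ≤ ∫ x in c..c + 1, L := intervalIntegral.integral_mono_on hle
        (hg.intervalIntegrable _ _) (by simp) fun x hx => (h x hx).2
    _ = L := by simp

/-- Sum and integral of a concave Lipschitz function over the integers, respectively the reals,
where it is nonnegative. -/
theorem abs_sum_sub_integral_posPart_le {f : ℝ → ℝ} (hc : ConcaveOn ℝ univ f) {L : ℝ}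
    (hL0 : 0 ≤ L) (hL : ∀ x y, |f x - f y| ≤ L * |x - y|) (J : Finset ℤ)
    (hJ : ∀ n : ℤ, n ∈ J ↔ 0 ≤ f n) :
    |∑ n ∈ J, f n - ∫ x, max (f x) 0| ≤ 5 * L := by
  have hcont : Continuous f :=
    (LipschitzWith.of_dist_le_mul (K := ⟨L, hL0⟩) fun x y => hL x y).continuous
  have hgcont : Continuous fun x => max (f x) 0 := hcont.max continuous_const
  have hunit : ∀ c x : ℝ, f c ≤ 0 → |x - c| ≤ 1 → max (f x) 0 ≤ L := by
    intro c x h1 h2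
    refine max_le ?_ hL0
    have h3 := (abs_le.mp (hL x c)).2
    have h4 : L * |x - c| ≤ L * 1 := by gcongr
    linarith
  rcases J.eq_empty_or_nonempty with rfl | hne
  · have hneg : ∀ n : ℤ, f n < 0 := fun n => by
      by_contra h
      push Not at h
      simpa using (hJ n).mpr h
    simp only [Finset.sum_empty, zero_sub, abs_neg]
    by_cases hall : ∀ x, f x ≤ 0
    · have : (fun x => max (f x) 0) = fun _ => 0 := by
        ext x; exact max_eq_right (hall x)
      rw [this]; simp; exact hL0
    · push Not at hall
      obtain ⟨x, hx⟩ := hall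
      have h1 := hneg ⌊x⌋
      have h2 := hneg (⌊x⌋ + 1)
      push_cast at h2
      rw [integral_posPart_eq (a := ⌊x⌋) (b := ⌊x⌋ + 1)
        (fun y hy => concave_nonpos_left hc h1 hx.le (Int.floor_le x) hy)
        (fun y hy => concave_nonpos_right hc h2 hx.le (Int.lt_floor_add_one x).le hy)]
      have := integral_unit_mem (c := ⌊x⌋) (L := L) hgcont fun y hy =>
        ⟨le_max_right _ _, hunit ⌊x⌋ y h1.le (by
          rw [abs_le]; constructor <;> linarith [hy.1, hy.2])⟩
      rw [abs_of_nonneg this.1]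
      linarith
  · have hord : (J : Set ℤ).OrdConnected := by
      refine ⟨fun a ha b hb c hcm => ?_⟩
      rw [Finset.mem_coe, hJ] at *
      have := hc.min_le_of_mem_Icc (mem_univ (a : ℝ)) (mem_univ (b : ℝ))
        (z := (c : ℝ)) ⟨by exact_mod_cast hcm.1, by exact_mod_cast hcm.2⟩
      exact (le_min ha hb).trans this
    obtain ⟨p, l, hiff, -, hsum⟩ := exists_range_of_ordConnected hord hne
    rw [hsum (fun n => f n)]
    have hp0 : 0 ≤ f p := (hJ p).mp ((hiff p).mpr ⟨le_rfl, by omega⟩)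
    have hq0 : 0 ≤ f (p + l) := by
      have := (hJ (p + l)).mp ((hiff (p + l)).mpr ⟨by omega, le_rfl⟩)
      push_cast at this
      exact this
    -- Negativity at the two neighbours `p - 1` and `p + l + 1` does two things: by concavity it
    -- confines the positive part to the interval between them, and by the Lipschitz bound it makes
    -- `f p` and `f (p + l)` at most `L`.
    have hp1 : f (p - 1) < 0 := by
      by_contra h
      push Not at h
      have := (hiff (p - 1)).mp ((hJ (p - 1)).mpr (by push_cast; exact h))
      omega
    have hq1 : f (p + l + 1) < 0 := by
      by_contra h
      push Not at h
      have := (hiff (p + l + 1)).mp ((hJ (p + l + 1)).mpr (by push_cast; exact h))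
      omega
    have hl0 : (0 : ℝ) ≤ l := l.cast_nonneg
    rw [integral_posPart_eq (a := p - 1) (b := p + l + 1)
      (fun y hy => concave_nonpos_left hc hp1 hp0 (by linarith) hy)
      (fun y hy => concave_nonpos_right hc hq1 hq0 (by linarith) hy)]
    have hii : ∀ a b : ℝ, IntervalIntegrable (fun x => max (f x) 0) volume a b :=
      fun a b => hgcont.intervalIntegrable a b
    rw [← intervalIntegral.integral_add_adjacent_intervals (hii (p - 1) p) (hii p (p + l + 1)),
      ← intervalIntegral.integral_add_adjacent_intervals (hii p (p + l)) (hii (p + l) (p + l + 1))]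
    have i1 := integral_unit_mem (c := p - 1) (L := L) hgcont fun y hy =>
        ⟨le_max_right _ _, hunit (p - 1) y hp1.le (by
          rw [abs_le]; constructor <;> linarith [hy.1, hy.2])⟩
    have i3 := integral_unit_mem (c := p + l) (L := L) hgcont fun y hy =>
        ⟨le_max_right _ _, hunit (p + l + 1) y hq1.le (by
          rw [abs_le]; constructor <;> linarith [hy.1, hy.2])⟩
    rw [sub_add_cancel] at i1
    have i2 : ∫ x in (p : ℝ)..p + l, max (f x) 0 = ∫ x in (p : ℝ)..p + l, f x := by
      apply intervalIntegral.integral_congr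
      intro x hx
      rw [uIcc_of_le (by linarith)] at hx
      exact max_eq_left ((le_min hp0 hq0).trans
        (hc.min_le_of_mem_Icc (mem_univ _) (mem_univ _) hx))
    have i4 : ∫ x in (p : ℝ)..p + l, f x =
        ∑ i ∈ Finset.range l, ∫ x in (p : ℝ) + i..p + i + 1, f x := by
      have := intervalIntegral.sum_integral_adjacent_intervals (f := f) (μ := volume)
        (a := fun i : ℕ => (p : ℝ) + i) (n := l) fun k _ => hcont.intervalIntegrable _ _
      simp only [Nat.cast_zero, add_zero] at this
      rw [← this]
      simp only [Nat.cast_add, Nat.cast_one, add_assoc]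
    have ilow : ∀ c : ℝ, f c + (f (c + 1) - f c) / 2 ≤ ∫ x in c..c + 1, f x := fun c => by
      rw [← integral_affine_unit (f c) (f (c + 1) - f c) c]
      exact intervalIntegral.integral_mono_on (by linarith)
        (Continuous.intervalIntegrable (by fun_prop) _ _) (hcont.intervalIntegrable _ _)
        fun x hx => concave_lower hc hx
    have iup : ∀ c : ℝ, ∫ x in c..c + 1, f x ≤ f c + (f c - f (c - 1)) / 2 := fun c => by
      rw [← integral_affine_unit (f c) (f c - f (c - 1)) c]
      exact intervalIntegral.integral_mono_on (by linarith) (hcont.intervalIntegrable _ _)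
        (Continuous.intervalIntegrable (by fun_prop) _ _)
        fun x hx => concave_upper hc hx
    -- On each unit interval a concave function lies above its chord and below the extension of the
    -- preceding chord. The resulting half-differences telescope, so only boundary values remain.
    have hlow : ∑ i ∈ Finset.range l, f (p + i) + (f (p + l) - f p) / 2 ≤
        ∫ x in (p : ℝ)..p + l, f x := by
      rw [i4]
      have tel := Finset.sum_range_sub (fun i : ℕ => f (p + i)) l
      calc _ = ∑ i ∈ Finset.range l, (f (p + i) + (f (p + i + 1) - f (p + i)) / 2) := by
            rw [Finset.sum_add_distrib, ← Finset.sum_div]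
            simp only [Nat.cast_add, Nat.cast_one, ← add_assoc, Nat.cast_zero, add_zero] at tel
            rw [tel]
        _ ≤ _ := Finset.sum_le_sum fun i _ => ilow _
    have hup : ∫ x in (p : ℝ)..p + l, f x ≤
        ∑ i ∈ Finset.range l, f (p + i) + (f (p + l - 1) - f (p - 1)) / 2 := by
      rw [i4]
      have tel := Finset.sum_range_sub (fun i : ℕ => f (p + i - 1)) l
      calc _ ≤ ∑ i ∈ Finset.range l, (f (p + i) + (f (p + i) - f (p + i - 1)) / 2) :=
            Finset.sum_le_sum fun i _ => iup _
        _ = _ := by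
            rw [Finset.sum_add_distrib, ← Finset.sum_div]
            simp only [Nat.cast_add, Nat.cast_one, ← add_assoc, Nat.cast_zero, add_zero,
              add_sub_cancel_right] at tel
            rw [tel]
    have b1 := abs_le.mp (hL p (p - 1))
    have b2 := abs_le.mp (hL (p + l) (p + l + 1))
    have b3 := abs_le.mp (hL (p + l - 1) (p + l))
    have a1 : |(p : ℝ) - (p - 1)| = 1 := by simp
    have a2 : |(p : ℝ) + l - (p + l + 1)| = 1 := by simp
    have a3 : |(p : ℝ) + l - 1 - (p + l)| = 1 := by simp
    rw [a1] at b1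
    rw [a2] at b2
    rw [a3] at b3
    rw [Finset.sum_range_succ, i2, abs_le]
    push_cast
    constructor <;> linarith [i1.1, i1.2, i3.1, i3.2, b1.1, b1.2, b2.1, b2.2, b3.1, b3.2]

/-! ### Minima of affine functions -/

/-- The minimum of finitely many affine functions. -/
noncomputable def minAffine {ι : Type*} (U : Finset ι) (hU : U.Nonempty) (s t : ι → ℝ) (x : ℝ) : ℝ :=
  U.inf' hU fun i => s i * x + t i

section

variable {ι : Type*} {U : Finset ι} (hU : U.Nonempty) {s t : ι → ℝ}

theorem minAffine_le {i : ι} (hi : i ∈ U) (x : ℝ) : minAffine U hU s t x ≤ s i * x + t i :=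
  Finset.inf'_le _ hi

theorem exists_minAffine_eq (x : ℝ) : ∃ i ∈ U, minAffine U hU s t x = s i * x + t i :=
  Finset.exists_mem_eq_inf' hU _

theorem le_minAffine_iff {x y : ℝ} : y ≤ minAffine U hU s t x ↔ ∀ i ∈ U, y ≤ s i * x + t i :=
  Finset.le_inf'_iff hU _

theorem concaveOn_minAffine : ConcaveOn ℝ univ (minAffine U hU s t) := by
  refine ⟨convex_univ, fun x _ y _ a b ha hb hab => ?_⟩
  rw [le_minAffine_iff]
  intro i hi
  have h1 := mul_le_mul_of_nonneg_left (minAffine_le hU (s := s) (t := t) hi x) ha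
  have h2 := mul_le_mul_of_nonneg_left (minAffine_le hU (s := s) (t := t) hi y) hb
  simp only [smul_eq_mul]
  calc _ ≤ a * (s i * x + t i) + b * (s i * y + t i) := add_le_add h1 h2
    _ = s i * (a * x + b * y) + (a + b) * t i := by ring
    _ = _ := by rw [hab, one_mul]

theorem minAffine_lipschitz {S : ℝ} (hS : ∀ i ∈ U, |s i| ≤ S) (x y : ℝ) :
    |minAffine U hU s t x - minAffine U hU s t y| ≤ S * |x - y| := by
  have key : ∀ x y : ℝ, minAffine U hU s t x - minAffine U hU s t y ≤ S * |x - y| := by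
    intro x y
    obtain ⟨i, hi, h⟩ := exists_minAffine_eq hU (s := s) (t := t) y
    have h1 := minAffine_le hU (s := s) (t := t) hi x
    have h2 : s i * (x - y) ≤ S * |x - y| :=
      (le_abs_self _).trans (by rw [abs_mul]; gcongr; exact hS i hi)
    rw [h]
    linarith
  rw [abs_le]
  have h := key y x
  rw [abs_sub_comm] at h
  exact ⟨by linarith, key x y⟩

/-- The sawtooth sum along the graph of a minimum of affine functions splits into sawtooth sums
along the single affine functions. -/
theorem abs_sum_saw_minAffine_le [LinearOrder ι] {E : ℝ} {Q : ℕ} (hE : ∀ i ∈ U, ∀ l ≤ Q, ∀ t : ℝ,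
      |∑ n ∈ Finset.range l, saw (s i * n + t)| ≤ E) {J : Finset ℤ}
    (hJ : (J : Set ℤ).OrdConnected) (hcard : J.card ≤ Q) :
    |∑ n ∈ J, saw (minAffine U hU s t n)| ≤ U.card * E := by
  have hex : ∀ n : ℤ, ∃ i ∈ U, ∀ j ∈ U, s i * n + t i ≤ s j * n + t j ∧
      (j < i → s i * n + t i < s j * n + t j) := by
    intro n
    -- The lexicographic order breaks ties by the smallest index, which makes the active index
    -- unique.
    obtain ⟨i, hi, h⟩ := Finset.exists_min_image U (fun i => toLex (s i * (n : ℝ) + t i, i)) hU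
    refine ⟨i, hi, fun j hj => ?_⟩
    have := h j hj
    rw [Prod.Lex.toLex_le_toLex] at this
    rcases this with h1 | ⟨h1, h2⟩
    · exact ⟨h1.le, fun _ => h1⟩
    · exact ⟨h1.le, fun h3 => absurd h2 (not_le.mpr h3)⟩
  choose g hgU hg using hex
  have huniq : ∀ (n : ℤ) (i : ι), i ∈ U → (∀ j ∈ U, s i * n + t i ≤ s j * n + t j ∧
      (j < i → s i * n + t i < s j * n + t j)) → g n = i := by
    intro n i hi h
    rcases lt_trichotomy (g n) i with h1 | h1 | h1
    · exact absurd ((h _ (hgU n)).2 h1) (not_lt.mpr (hg n i hi).1)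
    · exact h1
    · exact absurd ((hg n i hi).2 h1) (not_lt.mpr (h _ (hgU n)).1)
  rw [← Finset.sum_fiberwise_of_maps_to (t := U) (g := g) fun n _ => hgU n]
  refine (Finset.abs_sum_le_sum_abs _ _).trans ?_
  rw [← nsmul_eq_mul]
  refine Finset.sum_le_card_nsmul _ _ _ fun i hi => ?_
  have hval : ∀ n ∈ J.filter (fun n => g n = i),
      saw (minAffine U hU s t n) = saw (s i * n + t i) := by
    intro n hn
    rw [Finset.mem_filter] at hn
    congr 1
    refine le_antisymm (minAffine_le hU hi _) ?_
    rw [le_minAffine_iff]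
    intro j hj
    rw [← hn.2]
    exact (hg n j hj).1
  rw [Finset.sum_congr rfl hval]
  rcases (J.filter (fun n => g n = i)).eq_empty_or_nonempty with he | hne
  · rw [he, Finset.sum_empty, abs_zero]
    exact (abs_nonneg _).trans (hE i hi 0 (Nat.zero_le _) 0)
  -- The difference of two affine functions is monotone, so an index that wins at both `a` and `b`
  -- wins in between. Each index thus contributes a single arithmetic progression.
  have hord : ((J.filter (fun n => g n = i) : Finset ℤ) : Set ℤ).OrdConnected := by
    refine ⟨fun a ha b hb c hcm => ?_⟩
    simp only [Finset.coe_filter, mem_ofPred_eq] at ha hb ⊢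
    refine ⟨hJ.out ha.1 hb.1 hcm, huniq c i hi fun j hj => ?_⟩
    have h1 := hg a j hj
    have h2 := hg b j hj
    rw [ha.2] at h1
    rw [hb.2] at h2
    have hac : (a : ℝ) ≤ c := by exact_mod_cast hcm.1
    have hcb : (c : ℝ) ≤ b := by exact_mod_cast hcm.2
    rcases le_total (s i) (s j) with h | h
    · have h3 : (s j - s i) * a ≤ (s j - s i) * c :=
        mul_le_mul_of_nonneg_left hac (by linarith)
      exact ⟨by linarith [h1.1], fun h4 => by linarith [h1.2 h4]⟩
    · have h3 : (s i - s j) * c ≤ (s i - s j) * b :=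
        mul_le_mul_of_nonneg_left hcb (by linarith)
      exact ⟨by linarith [h2.1], fun h4 => by linarith [h2.2 h4]⟩
  obtain ⟨p, l, -, hc, hsum⟩ := exists_range_of_ordConnected hord hne
  rw [hsum (fun n : ℤ => saw (s i * n + t i))]
  have hlQ : l + 1 ≤ Q := by
    rw [← hc]
    exact (Finset.card_filter_le _ _).trans hcard
  have := hE i hi (l + 1) hlQ (s i * p + t i)
  have e : ∀ k : ℕ, s i * k + (s i * p + t i) = s i * ((p + k : ℤ) : ℝ) + t i := by
    intro k; push_cast; ring
  simpa only [e] using this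

end

/-! ### Integer points between two graphs -/

/-- The formula is exact also for an empty column: `F + G ≥ 0` gives `⌊F⌋ + ⌊G⌋ ≥ -1`, so `toNat`
never truncates. -/
theorem toNat_card_eq_saw {F G : ℝ} (h : 0 ≤ F + G) :
    (((⌊F⌋ + 1 - ⌈-G⌉).toNat : ℕ) : ℝ) = F + G - saw F - saw G := by
  have h1 : 0 ≤ ⌊F⌋ + 1 - ⌈-G⌉ := by
    rw [Int.ceil_neg]
    have h2 := Int.lt_floor_add_one F
    have h3 := Int.lt_floor_add_one G
    have h4 : (-2 : ℝ) < ((⌊F⌋ + ⌊G⌋ : ℤ) : ℝ) := by push_cast; linarith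
    have h5 : -2 < ⌊F⌋ + ⌊G⌋ := by exact_mod_cast h4
    omega
  have h2 : (((⌊F⌋ + 1 - ⌈-G⌉).toNat : ℕ) : ℝ) = ((⌊F⌋ + 1 - ⌈-G⌉ : ℤ) : ℝ) := by
    exact_mod_cast Int.toNat_of_nonneg h1
  rw [h2, Int.ceil_neg, saw, saw, Int.fract, Int.fract]
  push_cast
  ring

theorem volume_real_between {F G : ℝ → ℝ} (hF : Continuous F) (hG : Continuous G) :
    volume.real {w : ℝ × ℝ | -G w.1 ≤ w.2 ∧ w.2 ≤ F w.1} = ∫ x, max (F x + G x) 0 := by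
  have hmeas : MeasurableSet {w : ℝ × ℝ | -G w.1 ≤ w.2 ∧ w.2 ≤ F w.1} := by
    apply IsClosed.measurableSet
    apply IsClosed.inter
    · exact isClosed_le (hG.comp continuous_fst).neg continuous_snd
    · exact isClosed_le continuous_snd (hF.comp continuous_fst)
  have hint := integral_eq_lintegral_of_nonneg_ae (μ := volume) (f := fun x => max (F x + G x) 0)
    (Filter.Eventually.of_forall fun x => le_max_right _ _)
    ((hF.add hG).max continuous_const).aestronglyMeasurable
  rw [Measure.real, Measure.volume_eq_prod, Measure.prod_apply hmeas, hint]
  congr 2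
  ext x
  have : Prod.mk x ⁻¹' {w : ℝ × ℝ | -G w.1 ≤ w.2 ∧ w.2 ≤ F w.1} = Icc (-G x) (F x) := by
    ext y; simp
  rw [this, Real.volume_Icc, sub_neg_eq_add, ENNReal.ofReal_max]
  simp

/-- The number of integer points of a planar region between two graphs, in terms of sawtooth
sums. -/
theorem abs_ncard_sub_volume_le {F G : ℝ → ℝ} (hF : ConcaveOn ℝ univ F) (hG : ConcaveOn ℝ univ G)
    {S : ℝ} (hS : 0 ≤ S) (hFS : ∀ x y, |F x - F y| ≤ S * |x - y|)
    (hGS : ∀ x y, |G x - G y| ≤ S * |x - y|) {Q : ℕ} {E : ℝ}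
    (hfin : {n : ℤ | 0 ≤ F n + G n}.Finite) (hcard : {n : ℤ | 0 ≤ F n + G n}.ncard ≤ Q)
    (hEF : ∀ J : Finset ℤ, (J : Set ℤ).OrdConnected → J.card ≤ Q → |∑ n ∈ J, saw (F n)| ≤ E)
    (hEG : ∀ J : Finset ℤ, (J : Set ℤ).OrdConnected → J.card ≤ Q → |∑ n ∈ J, saw (G n)| ≤ E) :
    {z : ℤ × ℤ | ((z.1 : ℝ), (z.2 : ℝ)) ∈ {w : ℝ × ℝ | -G w.1 ≤ w.2 ∧ w.2 ≤ F w.1}}.Finite ∧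
    |({z : ℤ × ℤ | ((z.1 : ℝ), (z.2 : ℝ)) ∈
        {w : ℝ × ℝ | -G w.1 ≤ w.2 ∧ w.2 ≤ F w.1}}.ncard : ℝ) -
      volume.real {w : ℝ × ℝ | -G w.1 ≤ w.2 ∧ w.2 ≤ F w.1}| ≤ 2 * E + 10 * S := by
  have hcF : Continuous F :=
    (LipschitzWith.of_dist_le_mul (K := ⟨S, hS⟩) fun x y => hFS x y).continuous
  have hcG : Continuous G :=
    (LipschitzWith.of_dist_le_mul (K := ⟨S, hS⟩) fun x y => hGS x y).continuous
  rw [volume_real_between hcF hcG]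
  set J := hfin.toFinset with hJdef
  have hJ : ∀ n : ℤ, n ∈ J ↔ 0 ≤ F n + G n := fun n => by simp [hJdef]
  have hconc : ConcaveOn ℝ univ fun x => F x + G x := hF.add hG
  have hord : (J : Set ℤ).OrdConnected := by
    refine ⟨fun a ha b hb c hcm => ?_⟩
    rw [Finset.mem_coe, hJ] at *
    have := hconc.min_le_of_mem_Icc (mem_univ (a : ℝ)) (mem_univ (b : ℝ))
      (z := (c : ℝ)) ⟨by exact_mod_cast hcm.1, by exact_mod_cast hcm.2⟩
    exact (le_min ha hb).trans this
  have hJcard : J.card ≤ Q := by rwa [← Set.ncard_eq_toFinset_card _ hfin]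
  have hset : {z : ℤ × ℤ | ((z.1 : ℝ), (z.2 : ℝ)) ∈ {w : ℝ × ℝ | -G w.1 ≤ w.2 ∧ w.2 ≤ F w.1}} =
      ((J.sigma fun n => Finset.Icc ⌈-G n⌉ ⌊F n⌋).image fun z => (z.1, z.2) : Finset (ℤ × ℤ)) := by
    ext ⟨n, m⟩
    simp only [mem_ofPred_eq, Finset.coe_image, Set.mem_image, Finset.mem_coe, Finset.mem_sigma,
      Finset.mem_Icc, Int.ceil_le, Int.le_floor, hJ]
    constructor
    · rintro ⟨h1, h2⟩
      exact ⟨⟨n, m⟩, ⟨by linarith, h1, h2⟩, rfl⟩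
    · rintro ⟨⟨n', m'⟩, ⟨-, h1, h2⟩, h3⟩
      simp only [Prod.mk.injEq] at h3
      obtain ⟨rfl, rfl⟩ := h3
      exact ⟨h1, h2⟩
  rw [hset]
  refine ⟨Finset.finite_toSet _, ?_⟩
  rw [Set.ncard_coe_finset, Finset.card_image_of_injective, Finset.card_sigma]
  · push_cast
    have hcount : ∑ n ∈ J, ((Finset.Icc ⌈-G n⌉ ⌊F n⌋).card : ℝ) =
        ∑ n ∈ J, (F n + G n) - ∑ n ∈ J, saw (F n) - ∑ n ∈ J, saw (G n) := by
      rw [← Finset.sum_sub_distrib, ← Finset.sum_sub_distrib]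
      refine Finset.sum_congr rfl fun n hn => ?_
      rw [Int.card_Icc, toNat_card_eq_saw ((hJ n).mp hn)]
    rw [hcount]
    have h1 := abs_sum_sub_integral_posPart_le hconc (L := 2 * S) (by linarith) (fun x y => by
      have e : F x + G x - (F y + G y) = (F x - F y) + (G x - G y) := by ring
      rw [e]
      refine (abs_add_le _ _).trans ?_
      linarith [hFS x y, hGS x y]) J hJ
    have h2 := abs_le.mp (hEF J hord hJcard)
    have h3 := abs_le.mp (hEG J hord hJcard)
    rw [abs_le] at h1 ⊢
    constructor <;> linarith [h1.1, h1.2, h2.1, h2.2, h3.1, h3.2]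
  · rintro ⟨a, b⟩ ⟨c, d⟩ h
    simpa using h

/-! ### Translates far from rationals -/

/-- For `b ∈ [0,1]` only `q + 4` values of `p` can occur, and each accounts for an interval of
length `2 * η / q ^ 2`. The remaining factor `1 / q` later sums to a logarithm. -/
theorem volume_near_rational_le (a : ℝ) {q : ℕ} (hq : 1 ≤ q) {η : ℝ} (hη0 : 0 ≤ η) (hη : η ≤ 1) :
    volume {b ∈ Icc (0 : ℝ) 1 | ∃ p : ℤ, |q * (a - b) - p| < η / q} ≤
      ENNReal.ofReal (12 * η / q) := by
  have hq0 : (0 : ℝ) < q := by exact_mod_cast hq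
  have hq1 : (1 : ℝ) ≤ q := by exact_mod_cast hq
  have hηq : η / q ≤ 1 := by rw [div_le_one hq0]; linarith
  set m : ℤ := ⌊q * a⌋ with hm
  have hsub : {b ∈ Icc (0 : ℝ) 1 | ∃ p : ℤ, |q * (a - b) - p| < η / q} ⊆
      ⋃ p ∈ Finset.Icc (m - q - 1) (m + 2), Icc (a - p / q - η / q / q) (a - p / q + η / q / q) := by
    rintro b ⟨⟨hb0, hb1⟩, p, hp⟩
    have hfl := Int.floor_le (q * a)
    have hfl' := Int.lt_floor_add_one (q * a)
    rw [abs_lt] at hp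
    have hqb : (q : ℝ) * b ≤ q := by nlinarith
    have hqb0 : 0 ≤ (q : ℝ) * b := by positivity
    simp only [mem_iUnion, Finset.mem_Icc]
    refine ⟨p, ⟨?_, ?_⟩, ?_, ?_⟩
    · have : ((m - q - 1 - 1 : ℤ) : ℝ) < p := by push_cast; linarith [hp.1, hp.2]
      have := Int.cast_lt.mp this
      omega
    · have : (p : ℝ) < ((m + 3 : ℤ) : ℝ) := by push_cast; linarith [hp.1, hp.2]
      have := Int.cast_lt.mp this
      omega
    · rw [sub_sub, sub_le_comm, ← add_div, div_eq_mul_inv, ← div_eq_mul_inv, le_div_iff₀ hq0]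
      linarith [hp.1, hp.2]
    · rw [← sub_le_iff_le_add', sub_sub_eq_add_sub, le_div_iff₀ hq0, sub_mul, add_mul,
        div_mul_cancel₀ _ hq0.ne']
      linarith [hp.1, hp.2]
  refine (measure_mono hsub).trans ((measure_biUnion_finset_le _ _).trans ?_)
  have : ∀ p : ℤ, volume (Icc (a - p / q - η / q / q) (a - p / q + η / q / q)) =
      ENNReal.ofReal (2 * (η / q / q)) := by
    intro p
    rw [Real.volume_Icc]
    congr 1
    ring
  simp only [this, Finset.sum_const, Int.card_Icc, nsmul_eq_mul]
  rw [← ENNReal.ofReal_natCast, ← ENNReal.ofReal_mul (Nat.cast_nonneg _)]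
  apply ENNReal.ofReal_le_ofReal
  have hcard : (((m + 2 + 1 - (m - q - 1)).toNat : ℕ) : ℝ) = q + 4 := by
    have : (m + 2 + 1 - (m - q - 1)).toNat = q + 4 := by omega
    rw [this]; push_cast; ring
  rw [hcard]
  calc ((q : ℝ) + 4) * (2 * (η / q / q)) ≤ (6 * q) * (2 * (η / q / q)) := by
        gcongr; linarith
    _ = 12 * η / q := by field_simp; ring

/-- A translation making finitely many reals badly approximable. -/
theorem exists_translate_far_from_rationals (A : Finset ℝ) (Q : ℕ) {η : ℝ} (hη0 : 0 ≤ η)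
    (hη : η ≤ 1) (h : 12 * η * A.card * (1 + Real.log Q) < 1) :
    ∃ b ∈ Icc (0 : ℝ) 1, ∀ a ∈ A, ∀ q : ℕ, 1 ≤ q → q ≤ Q → ∀ p : ℤ,
      η / q ≤ |q * (a - b) - p| := by
  by_contra hcon
  push Not at hcon
  have hcov : Icc (0 : ℝ) 1 ⊆ ⋃ a ∈ A, ⋃ q ∈ Finset.Icc 1 Q,
      {b ∈ Icc (0 : ℝ) 1 | ∃ p : ℤ, |q * (a - b) - p| < η / q} := by
    intro b hb
    obtain ⟨a, ha, q, hq1, hqQ, p, hp⟩ := hcon b hb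
    simp only [mem_iUnion, Finset.mem_Icc]
    exact ⟨a, ha, q, ⟨hq1, hqQ⟩, hb, p, hp⟩
  have h1 : ∀ a ∈ A, volume (⋃ q ∈ Finset.Icc 1 Q,
      {b ∈ Icc (0 : ℝ) 1 | ∃ p : ℤ, |q * (a - b) - p| < η / q}) ≤
      ENNReal.ofReal (12 * η * (1 + Real.log Q)) := by
    intro a _
    refine (measure_biUnion_finset_le _ _).trans ?_
    calc _ ≤ ∑ q ∈ Finset.Icc 1 Q, ENNReal.ofReal (12 * η / q) :=
          Finset.sum_le_sum fun q hq =>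
            volume_near_rational_le a (Finset.mem_Icc.mp hq).1 hη0 hη
      _ = ENNReal.ofReal (∑ q ∈ Finset.Icc 1 Q, 12 * η / (q : ℝ)) :=
          (ENNReal.ofReal_sum_of_nonneg fun q _ => by positivity).symm
      _ ≤ _ := by
          apply ENNReal.ofReal_le_ofReal
          have := harmonic_le_one_add_log Q
          rw [harmonic_eq_sum_Icc] at this
          push_cast at this
          simp only [div_eq_mul_inv]
          rw [← Finset.mul_sum]
          gcongr
  have h2 : (1 : ℝ≥0∞) ≤ ENNReal.ofReal (12 * η * A.card * (1 + Real.log Q)) := by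
    calc (1 : ℝ≥0∞) = volume (Icc (0 : ℝ) 1) := by simp
      _ ≤ ∑ a ∈ A, ENNReal.ofReal (12 * η * (1 + Real.log Q)) :=
          (measure_mono hcov).trans ((measure_biUnion_finset_le _ _).trans
            (Finset.sum_le_sum h1))
      _ = _ := by
          rw [Finset.sum_const, nsmul_eq_mul, ← ENNReal.ofReal_natCast,
            ← ENNReal.ofReal_mul (Nat.cast_nonneg _)]
          congr 1
          ring
  rw [ENNReal.one_le_ofReal] at h2
  linarith

/-! ### A transversal direction and the slopes relative to it -/

theorem exists_abs_sub_int_mul_pi_lt {x r : ℝ} (h : |Real.sin x| < 2 / Real.pi * r) :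
    ∃ l : ℤ, |x - l * Real.pi| < r := by
  have hpi := Real.pi_pos
  refine ⟨round (x / Real.pi), ?_⟩
  set l := round (x / Real.pi)
  have h1 : |x - l * Real.pi| ≤ Real.pi / 2 := by
    have h2 := abs_sub_round (x / Real.pi)
    have h3 : x - l * Real.pi = (x / Real.pi - l) * Real.pi := by field_simp
    rw [h3, abs_mul, abs_of_pos hpi]
    calc _ ≤ 1 / 2 * Real.pi := by gcongr
      _ = Real.pi / 2 := by ring
  have h2 := Real.mul_abs_le_abs_sin h1
  have h3 : |Real.sin (x - l * Real.pi)| = |Real.sin x| := by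
    rw [Real.sin_sub_int_mul_pi, abs_mul, abs_neg_one_zpow, one_mul]
  rw [h3] at h2
  exact lt_of_mul_lt_mul_left (h2.trans_lt h) (by positivity)

/-- A set of directions of dimension less than one avoids a neighbourhood of some direction. -/
theorem exists_transversal_direction {Ω : Set ℝ} {s : ℝ} (hΩ : HasCoveringExponent Ω s)
    (hs : s < 1) : ∃ φ σ : ℝ, 0 < σ ∧ ∀ θ ∈ Ω ∪ {0, Real.pi / 2}, σ ≤ |Real.sin (θ - φ)| := by
  obtain ⟨C, hC, δ₀, hδ₀, hcov⟩ := hΩ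
  have hpi := Real.pi_pos
  -- There will be `M` candidate directions, spaced by `π / M = 4 * δ` modulo `π`. Because `s < 1`,
  -- the covering intervals are eventually fewer than the candidates.
  have hδlim : Filter.Tendsto (fun M : ℕ => Real.pi / 4 / (M : ℝ)) Filter.atTop (nhds 0) :=
    tendsto_const_div_atTop_nhds_zero_nat _
  have hlim : Filter.Tendsto (fun M : ℕ => C * (Real.pi / 4 / (M : ℝ)) ^ (1 - s) +
      2 * (Real.pi / 4 / (M : ℝ))) Filter.atTop (nhds 0) := by
    have h1 := hδlim.rpow_const (p := 1 - s) (Or.inr (by linarith))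
    rw [Real.zero_rpow (by linarith)] at h1
    simpa using (h1.const_mul C).add (hδlim.const_mul 2)
  obtain ⟨M, hM1, hM2, hM⟩ := ((hδlim.eventually_lt_const hδ₀).and
    ((hlim.eventually_lt_const (by positivity : (0 : ℝ) < Real.pi / 4)).and
      (Filter.eventually_ge_atTop 1))).exists
  have hM0 : (0 : ℝ) < M := by exact_mod_cast hM
  set δ := Real.pi / 4 / (M : ℝ) with hδ
  have hδ0 : 0 < δ := by positivity
  obtain ⟨t, ht, hcovt⟩ := hcov δ hδ0 hM1
  have hcard : ((insert 0 (insert (Real.pi / 2) t)).card : ℝ) < M := by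
    have h1 : ((insert 0 (insert (Real.pi / 2) t)).card : ℝ) ≤ t.card + 2 := by
      have h2 := Finset.card_insert_le (0 : ℝ) (insert (Real.pi / 2) t)
      have h3 := Finset.card_insert_le (Real.pi / 2 : ℝ) t
      have : (insert 0 (insert (Real.pi / 2) t)).card ≤ t.card + 2 := by omega
      exact_mod_cast this
    refine h1.trans_lt ?_
    have h2 : (C * δ ^ (-s) + 2) * δ < M * δ := by
      have e1 : δ ^ (1 - s) = δ ^ (-s) * δ := by
        rw [sub_eq_neg_add, Real.rpow_add hδ0, Real.rpow_one]
      have e2 : M * δ = Real.pi / 4 := by rw [hδ]; field_simp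
      rw [e2, add_mul, mul_assoc, ← e1]
      exact hM2
    have h3 := lt_of_mul_lt_mul_right h2 hδ0.le
    linarith
  set t' := insert 0 (insert (Real.pi / 2) t) with ht'
  have hcov' : ∀ θ ∈ Ω ∪ {0, Real.pi / 2}, ∃ a ∈ t', θ ∈ Icc a (a + δ) := by
    rintro θ (hθ | hθ | hθ)
    · have := hcovt hθ
      simp only [mem_iUnion] at this
      obtain ⟨a, ha, h⟩ := this
      exact ⟨a, by simp [ht', ha], h⟩
    · exact ⟨0, by simp [ht'], by simp only [hθ]; constructor <;> linarith⟩
    · rw [mem_singleton_iff] at hθ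
      exact ⟨Real.pi / 2, by simp [ht'], by simp only [hθ]; constructor <;> linarith⟩
  have hex : ∃ j ∈ Finset.range M, ∀ θ ∈ Ω ∪ {0, Real.pi / 2},
      2 / Real.pi * δ ≤ |Real.sin (θ - Real.pi * j / M)| := by
    by_contra hcon
    push Not at hcon
    choose! θ hθ hsin using hcon
    choose! a ha haI using hcov'
    -- Two candidates spoiled by the same interval would differ by less than `3 * δ` modulo `π`,
    -- which is below their spacing `4 * δ`.
    obtain ⟨j₁, hj₁, j₂, hj₂, hne, heq⟩ := Finset.exists_ne_map_eq_of_card_lt_of_maps_to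
      (s := Finset.range M) (t := t') (f := fun j => a (θ j))
      (by rw [Finset.card_range]; exact_mod_cast hcard) fun j hj => ha _ (hθ j hj)
    obtain ⟨l₁, hl₁⟩ := exists_abs_sub_int_mul_pi_lt (hsin j₁ hj₁)
    obtain ⟨l₂, hl₂⟩ := exists_abs_sub_int_mul_pi_lt (hsin j₂ hj₂)
    have hi₁ := haI _ (hθ j₁ hj₁)
    have hi₂ := haI _ (hθ j₂ hj₂)
    rw [heq] at hi₁
    have e : Real.pi = 4 * M * δ := by rw [hδ]; field_simp
    have e1 : Real.pi * j₁ / M = 4 * δ * j₁ := by rw [e]; field_simp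
    have e2 : Real.pi * j₂ / M = 4 * δ * j₂ := by rw [e]; field_simp
    rw [e1, e, abs_lt] at hl₁
    rw [e2, e, abs_lt] at hl₂
    have hz1 : δ * (((j₁ : ℝ) + l₁ * M) - (j₂ + l₂ * M)) < δ * 1 := by
      linarith [hi₁.1, hi₁.2, hi₂.1, hi₂.2]
    have hz2 : δ * (-1) < δ * (((j₁ : ℝ) + l₁ * M) - (j₂ + l₂ * M)) := by
      linarith [hi₁.1, hi₁.2, hi₂.1, hi₂.2]
    have hz1' := lt_of_mul_lt_mul_left hz1 hδ0.le
    have hz2' := lt_of_mul_lt_mul_left hz2 hδ0.le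
    have hz3 : (j₁ : ℤ) + l₁ * M - (j₂ + l₂ * M) < 1 := by exact_mod_cast hz1'
    have hz4 : -1 < (j₁ : ℤ) + l₁ * M - (j₂ + l₂ * M) := by exact_mod_cast hz2'
    have hz0 : (j₁ : ℤ) + l₁ * M - (j₂ + l₂ * M) = 0 := by omega
    have hz5 : (j₁ : ℤ) - j₂ = (l₂ - l₁) * M := by linarith
    rw [Finset.mem_range] at hj₁ hj₂
    have hl : l₂ - l₁ = 0 := by
      by_contra h
      rcases lt_or_gt_of_ne h with h | h <;> nlinarith
    rw [hl] at hz5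
    omega
  obtain ⟨j, -, h⟩ := hex
  exact ⟨_, 2 / Real.pi * δ, by positivity, h⟩

/-- The slope of the lines with normal `dir θ` in coordinates rotated by `φ`. -/
noncomputable def slope (φ θ : ℝ) : ℝ := -Real.cos (θ - φ) / Real.sin (θ - φ)

theorem abs_slope_le {φ θ σ : ℝ} (hσ : 0 < σ) (h : σ ≤ |Real.sin (θ - φ)|) :
    |slope φ θ| ≤ 1 / σ := by
  rw [slope, abs_div, abs_neg]
  have := Real.abs_cos_le_one (θ - φ)
  gcongr

theorem abs_slope_sub_le {φ θ θ' σ : ℝ} (hσ : 0 < σ) (h : σ ≤ |Real.sin (θ - φ)|)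
    (h' : σ ≤ |Real.sin (θ' - φ)|) : |slope φ θ - slope φ θ'| ≤ |θ - θ'| / σ ^ 2 := by
  have h0 : Real.sin (θ - φ) ≠ 0 := abs_pos.mp (hσ.trans_le h)
  have h0' : Real.sin (θ' - φ) ≠ 0 := abs_pos.mp (hσ.trans_le h')
  have e : slope φ θ - slope φ θ' = Real.sin (θ - θ') / (Real.sin (θ - φ) * Real.sin (θ' - φ)) := by
    have : θ - θ' = (θ - φ) - (θ' - φ) := by ring
    rw [this, Real.sin_sub, slope, slope]
    field_simp
    ring
  rw [e, abs_div, abs_mul, pow_two]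
  have := Real.abs_sin_le_abs (x := θ - θ')
  gcongr

/-! ### The rotated and sheared lattice -/

/-- The linear map that sends the integer lattice to a sheared, scaled and rotated lattice of
density `R ^ 2`. -/
noncomputable def latticeMap (φ β R : ℝ) : ℝ × ℝ →ₗ[ℝ] ℝ × ℝ :=
  Matrix.toLin (Module.Basis.finTwoProd ℝ) (Module.Basis.finTwoProd ℝ)
    !![(Real.cos φ - Real.sin φ * β) / R, -Real.sin φ / R;
      (Real.sin φ + Real.cos φ * β) / R, Real.cos φ / R]

theorem latticeMap_apply (φ β R : ℝ) (w : ℝ × ℝ) :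
    latticeMap φ β R w = ((Real.cos φ - Real.sin φ * β) / R * w.1 + -Real.sin φ / R * w.2,
      (Real.sin φ + Real.cos φ * β) / R * w.1 + Real.cos φ / R * w.2) := by
  rw [latticeMap, Matrix.toLin_finTwoProd_apply]

theorem det_latticeMap (φ β R : ℝ) : LinearMap.det (latticeMap φ β R) = (R ^ 2)⁻¹ := by
  rw [latticeMap, LinearMap.det_toLin, Matrix.det_fin_two_of]
  have := Real.sin_sq_add_cos_sq φ
  calc _ = (Real.sin φ ^ 2 + Real.cos φ ^ 2) * (R ^ 2)⁻¹ := by ring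
    _ = _ := by rw [this, one_mul]

theorem latticeMap_injective (φ β : ℝ) {R : ℝ} (hR : 0 < R) :
    Function.Injective (latticeMap φ β R) := by
  have : IsUnit (LinearMap.det (latticeMap φ β R)) := by
    rw [det_latticeMap, isUnit_iff_ne_zero]
    positivity
  exact (LinearMap.equivOfDetNeZero _ this.ne_zero).injective

theorem volume_preimage_latticeMap (φ β : ℝ) {R : ℝ} (hR : 0 < R) (B : Set (ℝ × ℝ)) :
    volume.real (latticeMap φ β R ⁻¹' B) = R ^ 2 * volume.real B := by
  have h : LinearMap.det (latticeMap φ β R) ≠ 0 := by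
    rw [det_latticeMap]
    positivity
  rw [Measure.real, Measure.addHaar_preimage_linearMap _ h, det_latticeMap, inv_inv,
    ENNReal.toReal_mul, ENNReal.toReal_ofReal (abs_nonneg _), abs_of_pos (by positivity)]
  rfl

/-- The first bound limits the number of lattice columns that meet the square. The second limits the
height within a column and serves to show that a polygon has sides both above and below. Shearing
along columns changes neither quantity. -/
theorem latticeMap_mem_unitSquare {φ β R : ℝ} (hR : 0 < R) {w w' : ℝ × ℝ}
    (hw : latticeMap φ β R w ∈ unitSquare) :
    |w.1| ≤ 2 * R ∧ (latticeMap φ β R w' ∈ unitSquare → w.1 = w'.1 →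
      (w.2 - w'.2) ^ 2 ≤ 2 * R ^ 2) := by
  have hsc := Real.sin_sq_add_cos_sq φ
  have hs := Real.abs_sin_le_one φ
  have hc := Real.abs_cos_le_one φ
  have hm : ∀ w, latticeMap φ β R w ∈ unitSquare →
      (∃ x ∈ Icc (0 : ℝ) 1, ∃ y ∈ Icc (0 : ℝ) 1,
        w.1 = R * (Real.cos φ * x + Real.sin φ * y) ∧
        w.2 + β * w.1 = R * (-Real.sin φ * x + Real.cos φ * y)) := by
    intro w hw
    have h1 : (latticeMap φ β R w).1 ∈ Icc (0 : ℝ) 1 := hw.1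
    have h2 : (latticeMap φ β R w).2 ∈ Icc (0 : ℝ) 1 := hw.2
    refine ⟨_, h1, _, h2, ?_, ?_⟩
    · rw [latticeMap_apply]
      field_simp
      linear_combination (-w.1) * hsc
    · rw [latticeMap_apply]
      field_simp
      linear_combination (-(w.2 + β * w.1)) * hsc
  obtain ⟨x, hx, y, hy, e1, e2⟩ := hm w hw
  have hxy : |x| ≤ 1 := by rw [abs_of_nonneg hx.1]; exact hx.2
  have hyy : |y| ≤ 1 := by rw [abs_of_nonneg hy.1]; exact hy.2
  constructor
  · rw [e1, abs_mul, abs_of_pos hR, mul_comm]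
    gcongr
    refine (abs_add_le _ _).trans ?_
    rw [abs_mul, abs_mul]
    have h1 : |Real.cos φ| * |x| ≤ 1 * 1 := by gcongr
    have h2 : |Real.sin φ| * |y| ≤ 1 * 1 := by gcongr
    linarith
  · intro hw' heq
    obtain ⟨x', hx', y', hy', e1', e2'⟩ := hm w' hw'
    have h0 : Real.cos φ * (x - x') + Real.sin φ * (y - y') = 0 := by
      have : R * (Real.cos φ * (x - x') + Real.sin φ * (y - y')) = R * 0 := by
        linear_combination e1' - e1 + heq
      exact mul_left_cancel₀ hR.ne' this
    have h1 : w.2 - w'.2 = R * (-Real.sin φ * (x - x') + Real.cos φ * (y - y')) := by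
      linear_combination e2 - e2' - β * heq
    have h2 : (-Real.sin φ * (x - x') + Real.cos φ * (y - y')) ^ 2 =
        (x - x') ^ 2 + (y - y') ^ 2 := by
      linear_combination ((x - x') ^ 2 + (y - y') ^ 2) * hsc -
        (Real.cos φ * (x - x') + Real.sin φ * (y - y')) * h0
    have h3 : (x - x') ^ 2 ≤ 1 := by
      have : |x - x'| ≤ 1 := by rw [abs_le]; constructor <;> linarith [hx.1, hx.2, hx'.1, hx'.2]
      exact (sq_le_one_iff_abs_le_one _).mpr this
    have h4 : (y - y') ^ 2 ≤ 1 := by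
      have : |y - y'| ≤ 1 := by rw [abs_le]; constructor <;> linarith [hy.1, hy.2, hy'.1, hy'.2]
      exact (sq_le_one_iff_abs_le_one _).mpr this
    rw [h1, mul_pow, h2, mul_comm]
    gcongr
    linarith

/-- The points of the lattice `latticeMap φ β R ℤ²` in a polygon with normals `± dir θ`, `θ ∈ Ω`,
inside the unit square. -/
theorem abs_ncard_lattice_sub_volume_le {Ω : Set ℝ} {φ σ β R E : ℝ} {Q k : ℕ} (hσ : 0 < σ)
    (hΩ : ∀ θ ∈ Ω, σ ≤ |Real.sin (θ - φ)|) (hβ : β ∈ Icc (0 : ℝ) 1) (hR : 0 < R)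
    (hQ : 4 * R + 1 ≤ Q) (hE : ∀ θ ∈ Ω, ∀ l ≤ Q, ∀ t : ℝ,
      |∑ n ∈ Finset.range l, saw ((slope φ θ - β) * n + t)| ≤ E ∧
      |∑ n ∈ Finset.range l, saw (-(slope φ θ - β) * n + t)| ≤ E) (hE0 : 0 ≤ E)
    {B : Set (ℝ × ℝ)} (hB : B ∈ convexPolygons Ω k) :
    {z : ℤ × ℤ | latticeMap φ β R ((z.1 : ℝ), (z.2 : ℝ)) ∈ B}.Finite ∧
    |({z : ℤ × ℤ | latticeMap φ β R ((z.1 : ℝ), (z.2 : ℝ)) ∈ B}.ncard : ℝ) -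
      R ^ 2 * volume.real B| ≤ 2 * (k * E) + 10 * (1 / σ + 1) := by
  obtain ⟨hsq, hint, m, hmk, ν, c, hν, hBeq⟩ := hB
  choose θ hθΩ hνθ using hν
  set e : Fin m → ℝ := fun i => if ν i = dir (θ i) then 1 else -1 with he
  have hνe : ∀ i, ν i = (e i * Real.cos (θ i), e i * Real.sin (θ i)) := by
    intro i
    simp only [he]
    split_ifs with h
    · rw [h, dir]; simp
    · rw [(hνθ i).resolve_left h, dir]; simp
  have he2 : ∀ i, e i ≠ 0 := by
    intro i; simp only [he]; split_ifs <;> norm_num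
  set D : Fin m → ℝ := fun i => e i * Real.sin (θ i - φ) with hD
  have hsin : ∀ i, Real.sin (θ i - φ) ≠ 0 := fun i => abs_pos.mp (hσ.trans_le (hΩ _ (hθΩ i)))
  have hD0 : ∀ i, D i ≠ 0 := fun i => mul_ne_zero (he2 i) (hsin i)
  set s : Fin m → ℝ := fun i => slope φ (θ i) - β with hs
  set T : Fin m → ℝ := fun i => c i * R / D i with hT
  have hhp : ∀ i w, latticeMap φ β R w ∈ halfPlane (ν i) (c i) ↔
      D i * (w.2 - s i * w.1) ≤ c i * R := by
    intro i w
    rw [halfPlane, mem_ofPred_eq, hνe i, latticeMap_apply]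
    have : (e i * Real.cos (θ i)) * ((Real.cos φ - Real.sin φ * β) / R * w.1 +
        -Real.sin φ / R * w.2) + (e i * Real.sin (θ i)) *
        ((Real.sin φ + Real.cos φ * β) / R * w.1 + Real.cos φ / R * w.2) =
        D i * (w.2 - s i * w.1) / R := by
      have h1 : Real.sin (θ i - φ) * slope φ (θ i) = -Real.cos (θ i - φ) := by
        rw [slope]; field_simp [hsin i]
      have h2 : D i * (w.2 - s i * w.1) = e i * (Real.sin (θ i - φ) * w.2 +
          Real.cos (θ i - φ) * w.1 + β * Real.sin (θ i - φ) * w.1) := by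
        simp only [hD, hs]
        linear_combination (-(e i * w.1)) * h1
      rw [h2, Real.sin_sub, Real.cos_sub]
      ring
    simp only
    rw [this, div_le_iff₀ hR]
  set U : Finset (Fin m) := Finset.univ.filter fun i => 0 < D i with hU
  set V : Finset (Fin m) := Finset.univ.filter fun i => D i < 0 with hV
  have hmem : ∀ w, latticeMap φ β R w ∈ B ↔
      (∀ i ∈ U, w.2 ≤ s i * w.1 + T i) ∧ (∀ i ∈ V, s i * w.1 + T i ≤ w.2) := by
    intro w
    rw [hBeq, mem_iInter]
    simp only [hhp, hU, hV, Finset.mem_filter, Finset.mem_univ, true_and, hT]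
    constructor
    · intro h
      refine ⟨fun i hi => ?_, fun i hi => ?_⟩
      · have := (le_div_iff₀' hi).mpr (h i)
        linarith
      · have := (div_le_iff_of_neg' hi).mpr (h i)
        linarith
    · rintro ⟨h1, h2⟩ i
      rcases lt_or_gt_of_ne (hD0 i) with hi | hi
      · exact (div_le_iff_of_neg' hi).mp (by linarith [h2 i hi])
      · exact (le_div_iff₀' hi).mp (by linarith [h1 i hi])
  have hfar : ∀ w w' : ℝ × ℝ, latticeMap φ β R w ∈ B → latticeMap φ β R w' ∈ B →
      w.1 = w'.1 → (w.2 - w'.2) ^ 2 ≤ 2 * R ^ 2 := fun w w' h h' =>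
    (latticeMap_mem_unitSquare hR (hsq h)).2 (hsq h')
  obtain ⟨p₀, hp₀⟩ := hint.mono interior_subset
  obtain ⟨w₀, hw₀⟩ : ∃ w, latticeMap φ β R w = p₀ := by
    have hdet : LinearMap.det (latticeMap φ β R) ≠ 0 := by
      rw [det_latticeMap]; positivity
    exact (LinearMap.equivOfDetNeZero _ hdet).surjective p₀
  rw [← hw₀, hmem] at hp₀
  -- Without an upper constraint, moving `w₀` up by `2 * R` would stay in `B`, although `(2 * R) ^ 2
  -- > 2 * R ^ 2`.
  have hUne : U.Nonempty := by
    by_contra h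
    rw [Finset.not_nonempty_iff_eq_empty] at h
    have h1 : latticeMap φ β R (w₀.1, w₀.2 + 2 * R) ∈ B := by
      rw [hmem]
      refine ⟨by simp [h], fun i hi => (hp₀.2 i hi).trans (by simp only; linarith)⟩
    have := hfar _ _ h1 ((hmem w₀).mpr hp₀) rfl
    simp only at this
    nlinarith
  have hVne : V.Nonempty := by
    by_contra h
    rw [Finset.not_nonempty_iff_eq_empty] at h
    have h1 : latticeMap φ β R (w₀.1, w₀.2 - 2 * R) ∈ B := by
      rw [hmem]
      refine ⟨fun i hi => le_trans (by simp only; linarith) (hp₀.1 i hi), by simp [h]⟩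
    have := hfar _ _ h1 ((hmem w₀).mpr hp₀) rfl
    simp only at this
    nlinarith
  set F := minAffine U hUne s T with hF
  set G := minAffine V hVne (fun i => -s i) (fun i => -T i) with hG
  have hset : ∀ w, latticeMap φ β R w ∈ B ↔
      w ∈ {w : ℝ × ℝ | -G w.1 ≤ w.2 ∧ w.2 ≤ F w.1} := by
    intro w
    rw [hmem, mem_ofPred_eq, neg_le, hF, hG, le_minAffine_iff, le_minAffine_iff, and_comm]
    refine and_congr_left' (forall₂_congr fun i _ => ?_)
    constructor <;> intro h <;> linarith
  have hS : ∀ i, |s i| ≤ 1 / σ + 1 := by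
    intro i
    refine (abs_sub _ _).trans (add_le_add (abs_slope_le hσ (hΩ _ (hθΩ i))) ?_)
    rw [abs_of_nonneg hβ.1]; exact hβ.2
  have hsubZ : {n : ℤ | 0 ≤ F n + G n} ⊆ (Finset.Icc (-⌊2 * R⌋) ⌊2 * R⌋ : Finset ℤ) := by
    intro n hn
    rw [mem_ofPred_eq] at hn
    have h1 : latticeMap φ β R ((n : ℝ), F n) ∈ B := by
      rw [hset]; exact ⟨by simp only; linarith, le_rfl⟩
    have h2 := abs_le.mp (latticeMap_mem_unitSquare (w' := 0) hR (hsq h1)).1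
    rw [Finset.coe_Icc, mem_Icc]
    refine ⟨?_, Int.le_floor.mpr h2.2⟩
    rw [neg_le]
    refine Int.le_floor.mpr ?_
    push_cast
    linarith [h2.1]
  have hfin : {n : ℤ | 0 ≤ F n + G n}.Finite := (Finset.finite_toSet _).subset hsubZ
  have hcardQ : {n : ℤ | 0 ≤ F n + G n}.ncard ≤ Q := by
    refine (Set.ncard_le_ncard hsubZ (Finset.finite_toSet _)).trans ?_
    rw [Set.ncard_coe_finset, Int.card_Icc]
    have h1 := Int.floor_le (2 * R)
    have h2 : ((⌊2 * R⌋ + 1 - -⌊2 * R⌋ : ℤ) : ℝ) ≤ ((Q : ℤ) : ℝ) := by push_cast; linarith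
    have h3 := Int.cast_le.mp h2
    omega
  have hcardle : ∀ W : Finset (Fin m), (W.card : ℝ) * E ≤ k * E := by
    intro W
    have h1 : W.card ≤ k := (W.card_le_univ.trans (by simp)).trans hmk
    have h2 : (W.card : ℝ) ≤ k := by exact_mod_cast h1
    gcongr
  have hS0 : 0 ≤ 1 / σ + 1 := by positivity
  have main := abs_ncard_sub_volume_le (F := F) (G := G) (S := 1 / σ + 1) (Q := Q) (E := k * E)
    (concaveOn_minAffine hUne) (concaveOn_minAffine hVne) hS0
    (minAffine_lipschitz hUne fun i _ => hS i)
    (minAffine_lipschitz hVne fun i _ => by rw [abs_neg]; exact hS i) hfin hcardQ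
    (fun J hJ hJQ => (abs_sum_saw_minAffine_le hUne
      (fun i _ l hl t => (hE _ (hθΩ i) l hl t).1) hJ hJQ).trans (hcardle U))
    (fun J hJ hJQ => (abs_sum_saw_minAffine_le hVne
      (fun i _ l hl t => (hE _ (hθΩ i) l hl t).2) hJ hJQ).trans (hcardle V))
  have e1 : {z : ℤ × ℤ | latticeMap φ β R ((z.1 : ℝ), (z.2 : ℝ)) ∈ B} =
      {z : ℤ × ℤ | ((z.1 : ℝ), (z.2 : ℝ)) ∈ {w : ℝ × ℝ | -G w.1 ≤ w.2 ∧ w.2 ≤ F w.1}} := by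
    ext z; exact hset _
  have e2 : {w : ℝ × ℝ | -G w.1 ≤ w.2 ∧ w.2 ≤ F w.1} = latticeMap φ β R ⁻¹' B := by
    ext w; exact (hset w).symm
  rw [e1, ← volume_preimage_latticeMap φ β hR B, ← e2]
  exact main

/-! ### Passing to exactly `N` points -/

/-- Once the angles `0` and `π / 2` are admitted, the lattice estimate applies to the square itself
and controls the total number of points. -/
theorem unitSquare_mem_convexPolygons {Ω : Set ℝ} (h0 : 0 ∈ Ω) (h1 : Real.pi / 2 ∈ Ω) :
    unitSquare ∈ convexPolygons Ω 4 := by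
  refine ⟨subset_rfl, ?_, 4, le_rfl, ![dir 0, -dir 0, dir (Real.pi / 2), -dir (Real.pi / 2)],
    ![1, 0, 1, 0], ?_, ?_⟩
  · rw [unitSquare, interior_prod_eq, interior_Icc]
    exact ⟨(1 / 2, 1 / 2), by constructor <;> constructor <;> norm_num⟩
  · intro i
    fin_cases i
    · exact ⟨0, h0, Or.inl rfl⟩
    · exact ⟨0, h0, Or.inr rfl⟩
    · exact ⟨_, h1, Or.inl rfl⟩
    · exact ⟨_, h1, Or.inr rfl⟩
  · ext ⟨x, y⟩
    simp [unitSquare, halfPlane, dir, Fin.forall_fin_succ]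
    tauto

theorem volume_unitSquare : volume.real unitSquare = 1 := by
  rw [unitSquare, Measure.volume_eq_prod, measureReal_prod_prod]
  simp

theorem convexPolygons_mono {Ω Ω' : Set ℝ} {k k' : ℕ} (h : Ω ⊆ Ω') (hk : k ≤ k') :
    convexPolygons Ω k ⊆ convexPolygons Ω' k' := by
  rintro B ⟨h1, h2, m, hm, ν, c, hν, hB⟩
  refine ⟨h1, h2, m, hm.trans hk, ν, c, fun i => ?_, hB⟩
  obtain ⟨θ, hθ, hi⟩ := hν i
  exact ⟨θ, h hθ, hi⟩

/-- A finite set with about `N` points in the square can be changed to have exactly `N` points. -/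
theorem discrepancy_le_of_finset {Ω : Set ℝ} {k N : ℕ} (hN1 : 1 ≤ N) {X : ℝ} (P : Finset (ℝ × ℝ))
    (hP : (P : Set (ℝ × ℝ)) ⊆ unitSquare) (hN : |(P.card : ℝ) - N| ≤ X)
    (hB : ∀ B ∈ convexPolygons Ω k,
      |(((P : Set (ℝ × ℝ)) ∩ B).ncard : ℝ) - N * volume.real B| ≤ X) :
    discrepancy Ω k N ≤ ENNReal.ofReal (2 * X) := by
  have key : ∃ P' : Finset (ℝ × ℝ), (P' : Set (ℝ × ℝ)) ⊆ unitSquare ∧ P'.card = N ∧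
      (P' ⊆ P ∨ P ⊆ P') := by
    rcases le_total N P.card with h | h
    · obtain ⟨P', h1, h2⟩ := Finset.exists_subset_card_eq h
      exact ⟨P', (Finset.coe_subset.mpr h1).trans hP, h2, Or.inl h1⟩
    · have hinf : unitSquare.Infinite := by
        intro hfin
        have := hfin.measure_zero volume
        have h2 := volume_unitSquare
        rw [Measure.real, this] at h2
        simp at h2
      obtain ⟨s, hPs, hs, hcard⟩ := hinf.exists_superset_ncard_eq hP P.finite_toSet
        (k := N) (by rw [Set.ncard_coe_finset]; exact h)
      -- `ncard` is `0` on infinite sets, so finiteness follows from `N ≥ 1`.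
      have hsfin : s.Finite := Set.finite_of_ncard_pos (by omega)
      refine ⟨hsfin.toFinset, by simpa using hs, ?_, Or.inr fun x hx => ?_⟩
      · rw [← hcard, Set.ncard_eq_toFinset_card _ hsfin]
      · rw [Set.Finite.mem_toFinset]
        exact hPs hx
  obtain ⟨P', hP', hcard, hsub⟩ := key
  refine iInf_le_of_le P' (iInf_le_of_le hP' (iInf_le_of_le hcard ?_))
  refine iSup₂_le fun B hBm => ENNReal.ofReal_le_ofReal ?_
  have h1 := hB B hBm
  have hdiff : ∀ A A' : Finset (ℝ × ℝ), A ⊆ A' →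
      |(((A' : Set (ℝ × ℝ)) ∩ B).ncard : ℝ) - ((A : Set (ℝ × ℝ)) ∩ B).ncard| ≤
        (A'.card : ℝ) - A.card := by
    classical
    intro A A' h
    have e : ∀ A : Finset (ℝ × ℝ), ((A : Set (ℝ × ℝ)) ∩ B).ncard = (A.filter (· ∈ B)).card := by
      intro A
      rw [← Set.ncard_coe_finset]
      congr 1
      ext x
      simp
    rw [e, e]
    have h2 := Finset.card_filter_add_card_filter_not (s := A') (· ∈ B)
    have h3 := Finset.card_filter_add_card_filter_not (s := A) (· ∈ B)
    have h4 := Finset.card_le_card (Finset.filter_subset_filter (· ∈ B) h)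
    have h5 := Finset.card_le_card (Finset.filter_subset_filter (¬ · ∈ B) h)
    have h4' : ((A.filter (· ∈ B)).card : ℝ) ≤ (A'.filter (· ∈ B)).card := by exact_mod_cast h4
    have h5' : ((A.filter (¬ · ∈ B)).card : ℝ) ≤ (A'.filter (¬ · ∈ B)).card := by
      exact_mod_cast h5
    have h2' : ((A'.filter (· ∈ B)).card : ℝ) + (A'.filter (¬ · ∈ B)).card = A'.card := by
      exact_mod_cast h2
    have h3' : ((A.filter (· ∈ B)).card : ℝ) + (A.filter (¬ · ∈ B)).card = A.card := by
      exact_mod_cast h3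
    rw [abs_of_nonneg (by linarith)]
    linarith
  rw [abs_le] at h1 hN ⊢
  rcases hsub with h | h
  · have h2 := abs_le.mp (hdiff _ _ h)
    rw [hcard] at h2
    constructor <;> linarith [h1.1, h1.2, h2.1, h2.2, hN.1, hN.2]
  · have h2 := abs_le.mp (hdiff _ _ h)
    rw [hcard] at h2
    constructor <;> linarith [h1.1, h1.2, h2.1, h2.2, hN.1, hN.2]

/-! ### The shear and the bound by covering numbers -/

theorem one_le_log' (N : ℕ) : 1 ≤ log' N := le_max_left _ _

theorem log_le_log' (N : ℕ) : Real.logb 2 N ≤ log' N := le_max_right _ _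

/-- Suitable shears make all slopes of a set that is covered by few short intervals badly
approximable. -/
theorem exists_shear {Ω : Set ℝ} {φ σ δ K : ℝ} {Q : ℕ} (hσ : 0 < σ)
    (hΩ : ∀ θ ∈ Ω, σ ≤ |Real.sin (θ - φ)|) (t : Finset ℝ)
    (ht : Ω ⊆ ⋃ a ∈ t, Icc a (a + δ)) {c : ℝ} (hc : 0 ≤ c) (hδQ : δ * Q ^ 2 ≤ c * K)
    (hK : 1 ≤ K) (hcK : 1 + c / σ ^ 2 ≤ K)
    (htK : 12 * (1 + c / σ ^ 2) * t.card * (1 + Real.log Q) < K) :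
    ∃ β ∈ Icc (0 : ℝ) 1, ∀ θ ∈ Ω, IsBadlyApproximable K Q (slope φ θ - β) := by
  classical
  have hK0 : 0 < K := by linarith
  set rep : ℝ → ℝ := fun a => if h : ∃ θ ∈ Ω, θ ∈ Icc a (a + δ) then h.choose else a with hrep
  set A := t.image (fun a => slope φ (rep a)) with hA
  -- Of this margin, `1 / K` is what must survive for every `θ`. The part `c / (σ ^ 2 * K)` is lost
  -- in passing from the representative of an interval to its other points.
  set η := (1 + c / σ ^ 2) / K with hη
  have hη0 : 0 ≤ η := by positivity
  have hη1 : η ≤ 1 := by rw [hη, div_le_one hK0]; exact hcK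
  have hlog : 0 ≤ 1 + Real.log Q := by
    have := Real.log_natCast_nonneg Q
    linarith
  have hAt : (A.card : ℝ) ≤ t.card := by exact_mod_cast Finset.card_image_le
  obtain ⟨β, hβ, hfar⟩ := exists_translate_far_from_rationals A Q hη0 hη1 (by
    calc 12 * η * A.card * (1 + Real.log Q) ≤ 12 * η * t.card * (1 + Real.log Q) := by gcongr
      _ = (12 * (1 + c / σ ^ 2) * t.card * (1 + Real.log Q)) / K := by rw [hη]; ring
      _ < 1 := by rw [div_lt_one hK0]; exact htK)
  refine ⟨β, hβ, fun θ hθ q hq hqK p => ?_⟩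
  have hθt := ht hθ
  simp only [mem_iUnion] at hθt
  obtain ⟨a, ha, hθa⟩ := hθt
  have hex : ∃ θ ∈ Ω, θ ∈ Icc a (a + δ) := ⟨θ, hθ, hθa⟩
  have hra : rep a ∈ Ω ∧ rep a ∈ Icc a (a + δ) := by
    simp only [hrep, dif_pos hex]
    exact hex.choose_spec
  have hq1 : (1 : ℝ) ≤ q := by exact_mod_cast hq
  have hq0 : (0 : ℝ) < q := by linarith
  have hqQ : q ≤ Q := by
    have : (q : ℝ) ≤ Q := le_trans (by nlinarith) hqK
    exact_mod_cast this
  have h1 := hfar _ (Finset.mem_image_of_mem _ ha) q hq hqQ p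
  have h2 := abs_slope_sub_le hσ (hΩ _ hra.1) (hΩ _ hθ)
  have h3 : |rep a - θ| ≤ δ := by
    rw [abs_le]; constructor <;> linarith [hra.2.1, hra.2.2, hθa.1, hθa.2]
  have h4 : q * |slope φ (rep a) - slope φ θ| ≤ (c / σ ^ 2) / (K * q) := by
    -- Only denominators with `q * K ≤ Q` matter, so `δ * Q ^ 2 ≤ c * K` suffices to absorb the
    -- perturbation.
    have h5 : δ * (q * K) * q ≤ c := by
      have hδ0 : 0 ≤ δ := (abs_nonneg _).trans h3
      have h6 : δ * (q * K) ^ 2 ≤ c * K := le_trans (by gcongr) hδQ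
      have h7 : (δ * (q * K) * q) * K ≤ c * K := by linarith [h6]
      exact le_of_mul_le_mul_right h7 hK0
    calc q * |slope φ (rep a) - slope φ θ| ≤ q * (δ / σ ^ 2) := by
          gcongr; exact h2.trans (by gcongr)
      _ = (δ * (q * K) * q) / σ ^ 2 / (K * q) := by field_simp
      _ ≤ _ := by gcongr
  have h5 : q * (slope φ (rep a) - β) - p =
      (q * (slope φ θ - β) - p) + q * (slope φ (rep a) - slope φ θ) := by ring
  rw [h5] at h1
  have h6 := h1.trans (abs_add_le _ _)
  rw [abs_mul, abs_of_pos hq0] at h6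
  have h7 : η / q = 1 / (K * q) + (c / σ ^ 2) / (K * q) := by
    rw [hη]; field_simp
  linarith

theorem sqrt_column_bounds {N : ℕ} (hN : 1 ≤ N) :
    ∃ Q : ℕ, 4 * √(N : ℝ) + 1 ≤ Q ∧ (Q : ℝ) ^ 2 ≤ 36 * N ∧ 1 + Real.log Q ≤ 5 * log' N ∧
      (Nat.size Q : ℝ) ≤ 5 * log' N := by
  have hN1 : (1 : ℝ) ≤ N := by exact_mod_cast hN
  have hsq : √(N : ℝ) ^ 2 = N := Real.sq_sqrt (by linarith)
  have hs1 : 1 ≤ √(N : ℝ) := by rw [Real.one_le_sqrt]; exact hN1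
  refine ⟨⌈4 * √(N : ℝ) + 1⌉₊, Nat.le_ceil _, ?_⟩
  set Q := ⌈4 * √(N : ℝ) + 1⌉₊ with hQ
  have hQ6 : (Q : ℝ) ≤ 6 * √(N : ℝ) := by
    have := Nat.ceil_lt_add_one (by positivity : 0 ≤ 4 * √(N : ℝ) + 1)
    linarith
  have hQ1 : (1 : ℝ) ≤ Q := le_trans (by linarith) (Nat.le_ceil (4 * √(N : ℝ) + 1))
  have hQ36 : (Q : ℝ) ^ 2 ≤ 36 * N := by
    calc (Q : ℝ) ^ 2 ≤ (6 * √(N : ℝ)) ^ 2 := by gcongr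
      _ = 36 * (N : ℝ) := by rw [mul_pow, hsq]; norm_num
  have hL1 := one_le_log' N
  have hlogQ : Real.logb 2 Q ≤ 4 * log' N := by
    have h1 : Real.logb 2 ((Q : ℝ) ^ 2) ≤ Real.logb 2 (2 ^ (6 : ℕ) * N) :=
      Real.logb_le_logb_of_le (by norm_num) (by positivity) (by linarith)
    rw [Real.logb_pow, Real.logb_mul (by norm_num) (by linarith), Real.logb_pow,
      Real.logb_self_eq_one (by norm_num)] at h1
    have := log_le_log' N
    push_cast at h1
    linarith
  have hln : Real.log Q ≤ Real.logb 2 Q := by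
    rw [Real.logb, le_div_iff₀ (Real.log_pos (by norm_num))]
    have h1 := Real.log_two_lt_d9
    have h2 := Real.log_nonneg hQ1
    nlinarith
  refine ⟨hQ36, by linarith, ?_⟩
  have hQpos : 0 < Q := by exact_mod_cast (by linarith : (0 : ℝ) < Q)
  obtain ⟨m, hm⟩ : ∃ m, Nat.size Q = m + 1 := by
    have := Nat.size_pos.mpr hQpos
    exact ⟨Nat.size Q - 1, by omega⟩
  have h2 : 2 ^ m ≤ Q := by
    rw [← Nat.lt_size]; omega
  have h3 : (m : ℝ) ≤ Real.logb 2 Q := by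
    rw [Real.le_logb_iff_rpow_le (by norm_num) (by linarith), Real.rpow_natCast]
    exact_mod_cast h2
  rw [hm]
  push_cast
  linarith

/-- The discrepancy in terms of the number of intervals of a certain length that cover `Ω`. -/
theorem exists_discrepancy_le_of_covering {Ω : Set ℝ} {s : ℝ} (hΩ : HasCoveringExponent Ω s)
    (hs : s < 1) (k : ℕ) : ∃ C : ℝ, 1 ≤ C ∧ ∀ N : ℕ, 1 ≤ N → ∀ (K δ : ℝ) (t : Finset ℝ),
      0 < δ → Ω ⊆ ⋃ a ∈ t, Icc a (a + δ) → δ * N ≤ K → C * (t.card + 1) * log' N ≤ K →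
      discrepancy Ω k N ≤ ENNReal.ofReal (C * K * log' N) := by
  obtain ⟨φ, σ, hσ, hφ⟩ := exists_transversal_direction hΩ hs
  set Ω' := Ω ∪ {0, Real.pi / 2} with hΩ'
  set k' := max k 4 with hk'
  set C₁ : ℝ := 1 + 120 * (1 + 36 / σ ^ 2) with hC₁
  set C₂ : ℝ := 2 * (2 * (k' * 30) + 10 * (1 / σ + 1)) with hC₂
  have hC₁1 : 1 ≤ C₁ := by
    have : 0 ≤ 120 * (1 + 36 / σ ^ 2) := by positivity
    linarith
  have hC₂0 : 0 ≤ C₂ := by positivity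
  refine ⟨C₁ + C₂, by linarith, fun N hN K δ t hδ ht hδK htK => ?_⟩
  have hN1 : (1 : ℝ) ≤ N := by exact_mod_cast hN
  have hL1 := one_le_log' N
  set n : ℝ := (t.card : ℝ) with hn
  have hn0 : 0 ≤ n := Nat.cast_nonneg _
  have hCK : C₁ * (n + 1) * log' N ≤ K := le_trans (by gcongr; linarith) htK
  have hnL : 1 ≤ (n + 1) * log' N := by nlinarith
  have hC₁K : C₁ ≤ K := by
    refine le_trans ?_ hCK
    rw [mul_assoc]
    exact le_mul_of_one_le_right (by linarith) hnL
  have hK1 : 1 ≤ K := hC₁1.trans hC₁K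
  obtain ⟨Q, hQ1, hQ2, hQ3, hQ4⟩ := sqrt_column_bounds hN
  set t' := insert 0 (insert (Real.pi / 2) t) with ht'
  have ht'card : (t'.card : ℝ) ≤ n + 2 := by
    have h2 := Finset.card_insert_le (0 : ℝ) (insert (Real.pi / 2) t)
    have h3 := Finset.card_insert_le (Real.pi / 2 : ℝ) t
    have h4 : t'.card ≤ t.card + 2 := by rw [ht']; omega
    rw [hn]
    exact_mod_cast h4
  have hcov' : Ω' ⊆ ⋃ a ∈ t', Icc a (a + δ) := by
    rintro θ (hθ | hθ | hθ)
    · have := ht hθ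
      simp only [mem_iUnion] at this ⊢
      obtain ⟨a, ha, h⟩ := this
      exact ⟨a, by simp [ht', ha], h⟩
    · simp only [mem_iUnion]
      exact ⟨0, by simp [ht'], by simp only [hθ]; constructor <;> linarith⟩
    · rw [mem_singleton_iff] at hθ
      simp only [mem_iUnion]
      exact ⟨Real.pi / 2, by simp [ht'], by simp only [hθ]; constructor <;> linarith⟩
  have hσ36 : 0 ≤ 36 / σ ^ 2 := by positivity
  -- The value `36` comes from `Q ^ 2 ≤ 36 * N` together with `δ * N ≤ K`.
  obtain ⟨β, hβ, hbad⟩ := exists_shear (K := K) (Q := Q) (c := 36) hσ hφ t' hcov' (by norm_num)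
    (by nlinarith) hK1 (by linarith) (by
      calc 12 * (1 + 36 / σ ^ 2) * t'.card * (1 + Real.log Q)
          ≤ 12 * (1 + 36 / σ ^ 2) * (n + 2) * (5 * log' N) := by gcongr
        _ ≤ 12 * (1 + 36 / σ ^ 2) * (2 * (n + 1)) * (5 * log' N) := by gcongr; linarith
        _ = (C₁ - 1) * ((n + 1) * log' N) := by rw [hC₁]; ring
        _ < C₁ * ((n + 1) * log' N) := by nlinarith
        _ ≤ K := by linarith)
  set E : ℝ := 30 * K * log' N with hE
  have hR0 : 0 < √(N : ℝ) := Real.sqrt_pos.mpr (by linarith)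
  have hE0 : 0 ≤ E := by positivity
  have hsaw : ∀ θ ∈ Ω', ∀ l ≤ Q, ∀ t : ℝ,
      |∑ n ∈ Finset.range l, saw ((slope φ θ - β) * n + t)| ≤ E ∧
      |∑ n ∈ Finset.range l, saw (-(slope φ θ - β) * n + t)| ≤ E := by
    intro θ hθ l hl x
    have hsz : 6 * K * (Nat.size l : ℝ) ≤ E := by
      have h1 : (Nat.size l : ℝ) ≤ Nat.size Q := by exact_mod_cast Nat.size_le_size hl
      calc 6 * K * (Nat.size l : ℝ) ≤ 6 * K * (5 * log' N) := by gcongr; linarith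
        _ = E := by rw [hE]; ring
    exact ⟨(abs_sum_saw_le (by linarith) (hbad θ hθ) l hl x).trans hsz,
      (abs_sum_saw_le (by linarith) (hbad θ hθ).neg l hl x).trans hsz⟩
  set X : ℝ := 2 * (k' * E) + 10 * (1 / σ + 1) with hX
  have hcount : ∀ B ∈ convexPolygons Ω' k',
      {z : ℤ × ℤ | latticeMap φ β √(N : ℝ) ((z.1 : ℝ), (z.2 : ℝ)) ∈ B}.Finite ∧
      |({z : ℤ × ℤ | latticeMap φ β √(N : ℝ) ((z.1 : ℝ), (z.2 : ℝ)) ∈ B}.ncard : ℝ) -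
        N * volume.real B| ≤ X := by
    intro B hB
    have := abs_ncard_lattice_sub_volume_le hσ hφ hβ hR0 hQ1 hsaw hE0 hB
    rwa [Real.sq_sqrt (by linarith)] at this
  set g : ℤ × ℤ → ℝ × ℝ := fun z => latticeMap φ β √(N : ℝ) ((z.1 : ℝ), (z.2 : ℝ)) with hg
  have hginj : Function.Injective g := by
    intro a b hab
    have := latticeMap_injective φ β hR0 hab
    simp only [Prod.mk.injEq, Int.cast_inj] at this
    exact Prod.ext this.1 this.2
  have hsqmem : unitSquare ∈ convexPolygons Ω' k' :=
    convexPolygons_mono subset_rfl (le_max_right _ _)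
      (unitSquare_mem_convexPolygons (by simp [hΩ']) (by simp [hΩ']))
  obtain ⟨hfin, hsqcount⟩ := hcount _ hsqmem
  set P : Finset (ℝ × ℝ) := hfin.toFinset.image g with hP
  have hPmem : ∀ x, x ∈ P ↔ ∃ z, g z ∈ unitSquare ∧ g z = x := by
    intro x; simp [hP, hg]
  have hPB : ∀ B ⊆ unitSquare, ((P : Set (ℝ × ℝ)) ∩ B).ncard = {z : ℤ × ℤ | g z ∈ B}.ncard := by
    intro B hB
    rw [← Set.ncard_image_of_injective _ hginj]
    congr 1
    ext x
    simp only [mem_inter_iff, Finset.mem_coe, hPmem, Set.mem_image, mem_ofPred_eq]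
    constructor
    · rintro ⟨⟨z, -, rfl⟩, h⟩
      exact ⟨z, h, rfl⟩
    · rintro ⟨z, h, rfl⟩
      exact ⟨⟨z, hB h, rfl⟩, h⟩
  have hPsq : (P : Set (ℝ × ℝ)) ⊆ unitSquare := by
    intro x hx
    obtain ⟨z, hz, rfl⟩ := (hPmem x).mp hx
    exact hz
  refine (discrepancy_le_of_finset hN (X := X) P hPsq ?_ fun B hB => ?_).trans
    (ENNReal.ofReal_le_ofReal ?_)
  · have h1 := hPB unitSquare subset_rfl
    rw [inter_eq_left.mpr hPsq, Set.ncard_coe_finset] at h1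
    rw [volume_unitSquare, mul_one] at hsqcount
    rw [h1]
    exact hsqcount
  · rw [hPB B hB.1]
    exact (hcount B (convexPolygons_mono subset_union_left (le_max_left _ _) hB)).2
  · have hKL : 1 ≤ K * log' N := by nlinarith
    calc 2 * X ≤ C₂ * (K * log' N) := by
          rw [hX, hC₂, hE]
          have : 0 ≤ 10 * (1 / σ + 1) := by positivity
          nlinarith
      _ ≤ (C₁ + C₂) * K * log' N := by
          have : 0 ≤ C₁ * (K * log' N) := mul_nonneg (by linarith) (by linarith)
          linarith

/-! ### The bound for sets of given dimension -/

theorem HasCoveringExponent.exists_covering_of_le_one {Ω : Set ℝ} {s : ℝ}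
    (h : HasCoveringExponent Ω s) (hs : 0 ≤ s) : ∃ C > (0 : ℝ), ∀ δ : ℝ, 0 < δ → δ ≤ 1 →
      ∃ t : Finset ℝ, (t.card : ℝ) ≤ C * δ ^ (-s) ∧ Ω ⊆ ⋃ a ∈ t, Icc a (a + δ) := by
  obtain ⟨C, hC, δ₀, hδ₀, hcov⟩ := h
  have hhalf : 0 < δ₀ / 2 := by linarith
  obtain ⟨t₁, ht₁, hcov₁⟩ := hcov (δ₀ / 2) hhalf (by linarith)
  have hp : 0 < (δ₀ / 2) ^ (-s) := Real.rpow_pos_of_pos hhalf _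
  refine ⟨C + C * (δ₀ / 2) ^ (-s), by positivity, fun δ hδ hδ1 => ?_⟩
  have h1 : 1 ≤ δ ^ (-s) := Real.one_le_rpow_of_pos_of_le_one_of_nonpos hδ hδ1 (by linarith)
  rcases lt_or_ge δ δ₀ with h | h
  · obtain ⟨t, ht, hc⟩ := hcov δ hδ h
    refine ⟨t, ht.trans ?_, hc⟩
    gcongr
    have : 0 ≤ C * (δ₀ / 2) ^ (-s) := by positivity
    linarith
  · refine ⟨t₁, ?_, hcov₁.trans (iUnion₂_mono fun a _ => Icc_subset_Icc_right (by linarith))⟩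
    calc (t₁.card : ℝ) ≤ (C + C * (δ₀ / 2) ^ (-s)) * 1 := by linarith
      _ ≤ _ := by gcongr

theorem log'_le_rpow {e : ℝ} (he : 0 < e) {N : ℕ} (hN : 1 ≤ N) :
    log' N ≤ (1 + 1 / (e * Real.log 2)) * (N : ℝ) ^ e := by
  have hN1 : (1 : ℝ) ≤ N := by exact_mod_cast hN
  have hl2 : 0 < Real.log 2 := Real.log_pos (by norm_num)
  have h1 : 1 ≤ (N : ℝ) ^ e := Real.one_le_rpow hN1 he.le
  have h2 := Real.log_le_rpow_div (by linarith : (0 : ℝ) ≤ N) he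
  have h3 : Real.logb 2 N ≤ 1 / (e * Real.log 2) * (N : ℝ) ^ e := by
    rw [Real.logb, div_le_iff₀ hl2]
    calc _ ≤ (N : ℝ) ^ e / e := h2
      _ = _ := by field_simp
  have h4 : 0 ≤ 1 / (e * Real.log 2) * (N : ℝ) ^ e := by positivity
  rw [log', add_mul, one_mul]
  exact max_le (by linarith) (by linarith)

/-- With `x = 1 - d` the two sides are `(1 - x) / (2 - x)` and `(1 - x²) / (2 - x²)`. The function
`(1 - u) / (2 - u)` is decreasing on `[0, 1]`, and `x² ≤ x`. -/
theorem dim_div_le_exponent {d τ : ℝ} (hd0 : 0 ≤ d) (hd : d < 1) (hτ : τ = 2 / (1 - d) ^ 2 - 2) :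
    d / (1 + d) ≤ τ / (2 * (τ + 1)) := by
  have hx : 0 < 1 - d := by linarith
  have h1 : 0 < 2 - (1 - d) ^ 2 := by nlinarith
  have e : τ / (2 * (τ + 1)) = (1 - (1 - d) ^ 2) / (2 - (1 - d) ^ 2) := by
    have h2 : τ + 1 = (2 - (1 - d) ^ 2) / (1 - d) ^ 2 := by rw [hτ]; field_simp; ring
    have h3 : τ = 2 * (1 - (1 - d) ^ 2) / (1 - d) ^ 2 := by rw [hτ]; field_simp
    rw [h2, h3]
    field_simp
  rw [e, div_le_div_iff₀ (by linarith) h1]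
  nlinarith [mul_nonneg hd0 hx.le]

theorem exists_discrepancy_le_of_dim {Ω : Set ℝ} (k : ℕ) {d τ : ℝ}
    (hdim : HasUpperMinkowskiDim Ω d) (hd : d < 1) (hτ : τ = 2 / (1 - d) ^ 2 - 2) {ε : ℝ}
    (hε : 0 < ε) : ∃ C > (0 : ℝ), ∀ N : ℕ, 1 ≤ N →
      discrepancy Ω k N ≤ ENNReal.ofReal (C * (N : ℝ) ^ (τ / (2 * (τ + 1)) + ε)) := by
  have hd0 : 0 ≤ d := hdim.2 fun s hs => hs.1
  set e := min (ε / 3) ((1 - d) / 2) with he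
  have he0 : 0 < e := lt_min (by linarith) (by linarith)
  have he1 : e ≤ ε / 3 := min_le_left _ _
  have he2 : e ≤ (1 - d) / 2 := min_le_right _ _
  obtain ⟨s, ⟨hs0, hcov⟩, hds, hse⟩ := hdim.exists_between (by linarith : d < d + e)
  have hs1 : s < 1 := by linarith
  obtain ⟨C, hC1, hdisc⟩ := exists_discrepancy_le_of_covering hcov hs1 k
  obtain ⟨C₁, hC₁, hcov₁⟩ := hcov.exists_covering_of_le_one hs0
  -- This `γ` solves `(1 - γ) * s + e = γ`: for `δ = N ^ (γ - 1)` the terms `δ * N` and (number of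
  -- intervals) × (logarithm) are both `O(N ^ γ)`.
  set γ := (s + e) / (1 + s) with hγ
  have hγ0 : 0 ≤ γ := by positivity
  have hγ1 : γ ≤ 1 := by rw [hγ, div_le_one (by linarith)]; linarith
  have hγs : (1 - γ) * s + e = γ := by
    have : γ * (1 + s) = s + e := by rw [hγ]; field_simp
    linarith
  have hγd : γ ≤ d / (1 + d) + 2 * e := by
    have h1 : γ ≤ (d + 2 * e) / (1 + d) := by
      exact div_le_div₀ (by linarith) (by linarith) (by linarith) (by linarith)
    refine h1.trans ?_
    rw [add_div]
    gcongr
    exact div_le_self (by linarith) (by linarith)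
  have hexp : γ + e ≤ τ / (2 * (τ + 1)) + ε := by
    have := dim_div_le_exponent hd0 hd hτ
    linarith
  have hl2 : 0 < Real.log 2 := Real.log_pos (by norm_num)
  set C₃ := 1 + 1 / (e * Real.log 2) with hC₃
  have hC₃1 : 1 ≤ C₃ := by
    have : 0 ≤ 1 / (e * Real.log 2) := by positivity
    linarith
  set C₄ := C * (C₁ + 1) * C₃ with hC₄
  have hC₄1 : 1 ≤ C₄ := by
    have : 1 ≤ C * (C₁ + 1) := by nlinarith
    rw [hC₄]; nlinarith
  refine ⟨C * C₄ * C₃, by positivity, fun N hN => ?_⟩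
  have hN1 : (1 : ℝ) ≤ N := by exact_mod_cast hN
  have hN0 : (0 : ℝ) < N := by linarith
  obtain ⟨t, ht, htcov⟩ := hcov₁ ((N : ℝ) ^ (γ - 1)) (Real.rpow_pos_of_pos hN0 _)
    (Real.rpow_le_one_of_one_le_of_nonpos hN1 (by linarith))
  have hL := log'_le_rpow he0 hN
  have hL0 := one_le_log' N
  have htcard : (t.card : ℝ) + 1 ≤ (C₁ + 1) * (N : ℝ) ^ ((1 - γ) * s) := by
    rw [← Real.rpow_mul hN0.le, show (γ - 1) * -s = (1 - γ) * s by ring] at ht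
    have : 1 ≤ (N : ℝ) ^ ((1 - γ) * s) :=
      Real.one_le_rpow hN1 (mul_nonneg (by linarith) hs0)
    linarith
  refine (hdisc N hN (C₄ * (N : ℝ) ^ γ) ((N : ℝ) ^ (γ - 1)) t (Real.rpow_pos_of_pos hN0 _)
    htcov ?_ ?_).trans (ENNReal.ofReal_le_ofReal ?_)
  · rw [← Real.rpow_add_one hN0.ne', sub_add_cancel]
    exact le_mul_of_one_le_left (by positivity) hC₄1
  · calc C * (t.card + 1) * log' N
        ≤ C * ((C₁ + 1) * (N : ℝ) ^ ((1 - γ) * s)) * (C₃ * (N : ℝ) ^ e) := by gcongr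
      _ = C₄ * ((N : ℝ) ^ ((1 - γ) * s) * (N : ℝ) ^ e) := by rw [hC₄]; ring
      _ = C₄ * (N : ℝ) ^ γ := by rw [← Real.rpow_add hN0, hγs]
  · calc C * (C₄ * (N : ℝ) ^ γ) * log' N
        ≤ C * (C₄ * (N : ℝ) ^ γ) * (C₃ * (N : ℝ) ^ e) := by gcongr
      _ = C * C₄ * C₃ * ((N : ℝ) ^ γ * (N : ℝ) ^ e) := by ring
      _ = C * C₄ * C₃ * (N : ℝ) ^ (γ + e) := by rw [← Real.rpow_add hN0]
      _ ≤ _ := by gcongr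

/-! ### Coverings of lacunary sets -/

/-- `Ω` is covered by `O((1 - log δ) ^ M)` intervals of length `δ`. -/
def HasLogCovering (M : ℕ) (Ω : Set ℝ) : Prop :=
  ∃ C > (0 : ℝ), ∀ δ : ℝ, 0 < δ → δ ≤ 1 →
    ∃ t : Finset ℝ, (t.card : ℝ) ≤ C * (1 - Real.log δ) ^ M ∧ Ω ⊆ ⋃ a ∈ t, Icc a (a + δ)

theorem one_le_one_sub_log {δ : ℝ} (h0 : 0 < δ) (h1 : δ ≤ 1) : 1 ≤ 1 - Real.log δ := by
  have := Real.log_nonpos h0.le h1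
  linarith

theorem HasLogCovering.mono {M M' : ℕ} {Ω : Set ℝ} (h : HasLogCovering M Ω) (hM : M ≤ M') :
    HasLogCovering M' Ω := by
  obtain ⟨C, hC, hcov⟩ := h
  refine ⟨C, hC, fun δ h0 h1 => ?_⟩
  obtain ⟨t, ht, htc⟩ := hcov δ h0 h1
  refine ⟨t, ht.trans ?_, htc⟩
  gcongr
  exact one_le_one_sub_log h0 h1

theorem HasLogCovering.union {M : ℕ} {Ω Ω' : Set ℝ} (h : HasLogCovering M Ω)
    (h' : HasLogCovering M Ω') : HasLogCovering M (Ω ∪ Ω') := by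
  classical
  obtain ⟨C, hC, hcov⟩ := h
  obtain ⟨C', hC', hcov'⟩ := h'
  refine ⟨C + C', by positivity, fun δ h0 h1 => ?_⟩
  obtain ⟨t, ht, htc⟩ := hcov δ h0 h1
  obtain ⟨t', ht', htc'⟩ := hcov' δ h0 h1
  refine ⟨t ∪ t', ?_, ?_⟩
  · have : ((t ∪ t').card : ℝ) ≤ t.card + t'.card := by exact_mod_cast Finset.card_union_le t t'
    linarith
  · rw [Finset.set_biUnion_union]
    exact union_subset_union htc htc'

theorem HasLogCovering.sUnion {M : ℕ} {S : Set (Set ℝ)} (hS : S.Finite)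
    (h : ∀ T ∈ S, HasLogCovering M T) : HasLogCovering M (⋃₀ S) := by
  induction S, hS using Set.Finite.induction_on with
  | empty =>
    refine ⟨1, one_pos, fun δ h0 h1 => ⟨∅, ?_, by simp⟩⟩
    have := one_le_one_sub_log h0 h1
    simp only [Finset.card_empty, Nat.cast_zero]
    positivity
  | insert _ _ ih =>
    rw [sUnion_insert]
    exact (h _ (mem_insert _ _)).union (ih fun T hT => h T (mem_insert_of_mem _ hT))

theorem IsLacunarySeq.abs_sub_le {A a : ℝ} {u : ℕ → ℝ} (hu : IsLacunarySeq A a u) (hA : 0 < A)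
    (n j : ℕ) : |u (n + j) - a| ≤ A ^ j * |u n - a| := by
  induction j with
  | zero => simp
  | succ j ih =>
    have := (hu (n + j)).2.le
    rw [← add_assoc, pow_succ']
    calc _ ≤ A * |u (n + j) - a| := this
      _ ≤ A * (A ^ j * |u n - a|) := by gcongr
      _ = _ := by ring

/-- A lacunary sequence has few terms whose distance from the limit is in a given range. -/
theorem IsLacunarySeq.exists_finset {A a : ℝ} {u : ℕ → ℝ} (hu : IsLacunarySeq A a u) (hA : 0 < A)
    (hA1 : A < 1) {D : ℝ} (hD : 1 ≤ D) {δ : ℝ} (h0 : 0 < δ) (h1 : δ ≤ 1) :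
    ∃ T : Finset ℝ, (T.card : ℝ) ≤ (1 + (1 + Real.log D) / -Real.log A) * (1 - Real.log δ) ∧
      ∀ x ∈ range u, δ < |x - a| → |x - a| ≤ D → x ∈ T := by
  classical
  have hlA : 0 < -Real.log A := by linarith [Real.log_neg hA hA1]
  have hlD : 0 ≤ Real.log D := Real.log_nonneg hD
  have hlδ : Real.log δ ≤ 0 := Real.log_nonpos h0.le h1
  by_cases hex : ∃ n, |u n - a| ≤ D
  · set n₀ := Nat.find hex with hn₀
    -- From the first term within `D` of the limit, `A ^ j * D` falls below `δ` once `j > J`.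
    set J := (Real.log D - Real.log δ) / -Real.log A with hJ
    have hJ0 : 0 ≤ J := div_nonneg (by linarith) hlA.le
    refine ⟨(Finset.range (⌊J⌋₊ + 1)).image fun j => u (n₀ + j), ?_, ?_⟩
    · have h2 : (((Finset.range (⌊J⌋₊ + 1)).image fun j => u (n₀ + j)).card : ℝ) ≤ ⌊J⌋₊ + 1 := by
        have := Finset.card_image_le (s := Finset.range (⌊J⌋₊ + 1)) (f := fun j => u (n₀ + j))
        rw [Finset.card_range] at this
        exact_mod_cast this
      have h3 := Nat.floor_le hJ0
      have h4 : J ≤ (1 + Real.log D) / -Real.log A * (1 - Real.log δ) := by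
        rw [hJ, div_mul_eq_mul_div]
        gcongr
        nlinarith
      rw [add_mul, one_mul]
      linarith
    · rintro x ⟨n, rfl⟩ hδx hxD
      have hn : n₀ ≤ n := Nat.find_min' hex hxD
      obtain ⟨j, rfl⟩ := Nat.exists_eq_add_of_le hn
      rw [Finset.mem_image]
      refine ⟨j, ?_, rfl⟩
      rw [Finset.mem_range, Nat.lt_succ_iff]
      apply Nat.le_floor
      have h2 : δ ≤ A ^ j * D := by
        refine hδx.le.trans ((hu.abs_sub_le hA n₀ j).trans ?_)
        have := Nat.find_spec hex
        gcongr
      have h3 := Real.log_le_log h0 h2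
      rw [Real.log_mul (by positivity) (by positivity), Real.log_pow] at h3
      rw [hJ, le_div_iff₀ hlA]
      linarith
  · push Not at hex
    refine ⟨∅, ?_, ?_⟩
    · simp only [Finset.card_empty, Nat.cast_zero]
      have : 0 ≤ (1 + Real.log D) / -Real.log A := div_nonneg (by linarith) hlA.le
      exact mul_nonneg (by linarith) (by linarith)
    · rintro x ⟨n, rfl⟩ - hxD
      exact absurd hxD (not_le.mpr (hex n))

theorem mem_cover_of_abs_sub_le {a δ x c : ℝ} (ha : a ∈ Icc c (c + δ)) (h : |x - a| ≤ δ) :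
    x ∈ Icc c (c + δ) ∨ x ∈ Icc (c - δ) (c - δ + δ) ∨ x ∈ Icc (c + δ) (c + δ + δ) := by
  rw [abs_le] at h
  simp only [mem_Icc] at *
  by_cases h1 : x ≤ c
  · right; left; constructor <;> linarith
  · by_cases h2 : x ≤ c + δ
    · left; constructor <;> linarith
    · right; right; constructor <;> linarith

theorem IsLacunarySeq.hasLogCovering {A a : ℝ} {u : ℕ → ℝ} (hu : IsLacunarySeq A a u) (hA : 0 < A)
    (hA1 : A < 1) {Ω : Set ℝ} (hΩ : Ω ⊆ range u) : HasLogCovering 1 Ω := by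
  classical
  set D := max 1 |u 0 - a| with hD
  set C := 1 + (1 + Real.log D) / -Real.log A with hC
  have hlA : 0 < -Real.log A := by linarith [Real.log_neg hA hA1]
  have hC0 : 0 < C := by
    have := Real.log_nonneg (le_max_left 1 |u 0 - a|)
    positivity
  refine ⟨C + 3, by linarith, fun δ h0 h1 => ?_⟩
  obtain ⟨T, hT, hmem⟩ := hu.exists_finset hA hA1 (le_max_left 1 |u 0 - a|) h0 h1
  refine ⟨T ∪ {a, a - δ, a + δ}, ?_, fun x hx => ?_⟩
  · have h2 : ((T ∪ {a, a - δ, a + δ}).card : ℝ) ≤ T.card + 3 := by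
      have h3 := Finset.card_union_le T {a, a - δ, a + δ}
      have h4 : ({a, a - δ, a + δ} : Finset ℝ).card ≤ 3 := Finset.card_le_three
      exact_mod_cast h3.trans (by omega)
    have h3 := one_le_one_sub_log h0 h1
    rw [← hD, ← hC] at hT
    rw [pow_one, add_mul]
    linarith
  · simp only [mem_iUnion]
    by_cases h : |x - a| ≤ δ
    · rcases mem_cover_of_abs_sub_le (c := a) ⟨le_rfl, by linarith⟩ h with h2 | h2 | h2
      · exact ⟨a, by simp, h2⟩
      · exact ⟨a - δ, by simp, h2⟩
      · exact ⟨a + δ, by simp, h2⟩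
    · push Not at h
      refine ⟨x, Finset.mem_union_left _ (hmem x (hΩ hx) h ?_), le_rfl, by linarith⟩
      obtain ⟨n, rfl⟩ := hΩ hx
      have h2 := hu.abs_sub_le hA 0 n
      rw [zero_add] at h2
      refine (h2.trans ?_).trans (le_max_right _ _)
      exact mul_le_of_le_one_left (abs_nonneg _) (pow_le_one₀ hA.le hA1.le)

theorem HasLogCovering.exists_abs_le {M : ℕ} {Ω : Set ℝ} (h : HasLogCovering M Ω) :
    ∃ D, 1 ≤ D ∧ ∀ x ∈ closure Ω, |x| ≤ D := by
  obtain ⟨C, -, hcov⟩ := h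
  obtain ⟨t, -, ht⟩ := hcov 1 one_pos le_rfl
  have hb : Bornology.IsBounded Ω :=
    ((Bornology.isBounded_biUnion_finset t).mpr fun a _ => Metric.isBounded_Icc _ _).subset ht
  obtain ⟨D, hD⟩ := hb.closure.exists_norm_le
  exact ⟨max 1 D, le_max_left _ _, fun x hx => (hD x hx).trans (le_max_right _ _)⟩

/-- The distance of a point of a lacunary set of higher order from its limit point is bounded. -/
theorem exists_abs_sub_le_of_disjoint {Ω' : Set ℝ} {D₀ A : ℝ} (hA : 0 < A) (hA1 : A < 1)
    (hD₀ : ∀ x ∈ closure Ω', |x| ≤ D₀) (u : ℝ → ℕ → ℝ)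
    (hu : ∀ a ∈ closure Ω', IsLacunarySeq A a (u a)) :
    ∃ D, 1 ≤ D ∧ ∀ a ∈ closure Ω', ∀ x ∈ range (u a), Disjoint (openSegment ℝ a x) Ω' →
      |x - a| ≤ D := by
  refine ⟨1 + 2 * |D₀| + |u (sSup Ω') 0 - sSup Ω'| + |u (sInf Ω') 0 - sInf Ω'|, ?_, ?_⟩
  · have h1 := abs_nonneg D₀
    have h2 := abs_nonneg (u (sSup Ω') 0 - sSup Ω')
    have h3 := abs_nonneg (u (sInf Ω') 0 - sInf Ω')
    linarith
  intro a ha x hx hdisj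
  have h1 := abs_nonneg (u (sSup Ω') 0 - sSup Ω')
  have h2 := abs_nonneg (u (sInf Ω') 0 - sInf Ω')
  have hseq : |x - a| ≤ |u a 0 - a| := by
    obtain ⟨n, rfl⟩ := hx
    have h3 := (hu a ha).abs_sub_le hA 0 n
    rw [zero_add] at h3
    exact h3.trans (mul_le_of_le_one_left (abs_nonneg _) (pow_le_one₀ hA.le hA1.le))
  have ha' := abs_le.mp (hD₀ a ha)
  have hD₀' := le_abs_self D₀
  have hne : Ω'.Nonempty := closure_nonempty_iff.mp ⟨a, ha⟩
  by_cases hxD : |x| ≤ D₀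
  · rw [abs_le] at hxD ⊢
    constructor <;> linarith [hxD.1, hxD.2]
  · rcases le_total a x with hax | hax
    · have hxgt : D₀ < x := by
        rw [abs_le] at hxD; by_contra h; exact hxD ⟨by linarith, by linarith⟩
      have hub : a ∈ upperBounds Ω' := by
        intro y hy
        by_contra hya
        push Not at hya
        have hyD := abs_le.mp (hD₀ y (subset_closure hy))
        refine Set.disjoint_left.mp hdisj ?_ hy
        rw [openSegment_eq_Ioo (by linarith)]
        exact ⟨hya, by linarith⟩
      -- No bound is uniform over all the sequences, but a term beyond every point of `Ω'` can only
      -- belong to an extreme point. Thus only the initial terms at `sSup Ω'` and `sInf Ω'` enter.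
      have : a = sSup Ω' := ((isLUB_of_mem_closure hub ha).csSup_eq hne).symm
      rw [← this] at h1 ⊢
      have := abs_nonneg D₀
      linarith
    · have hxlt : x < -D₀ := by
        rw [abs_le] at hxD; by_contra h; exact hxD ⟨by linarith, by linarith⟩
      have hlb : a ∈ lowerBounds Ω' := by
        intro y hy
        by_contra hya
        push Not at hya
        have hyD := abs_le.mp (hD₀ y (subset_closure hy))
        refine Set.disjoint_left.mp hdisj ?_ hy
        rw [openSegment_symm, openSegment_eq_Ioo (by linarith)]
        exact ⟨by linarith, hya⟩
      have : a = sInf Ω' := ((isGLB_of_mem_closure hlb ha).csInf_eq hne).symm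
      rw [← this] at h2 ⊢
      have := abs_nonneg D₀
      linarith

/-- The terms of lacunary sequences that converge to points of a short interval and that lie
outside a neighbourhood of it. -/
theorem exists_finset_of_interval {Ω' : Set ℝ} {A : ℝ} (hA : 0 < A) (hA1 : A < 1) (u : ℝ → ℕ → ℝ)
    (hu : ∀ a ∈ closure Ω', IsLacunarySeq A a (u a)) {D : ℝ} (hD : 1 ≤ D) {δ : ℝ} (h0 : 0 < δ)
    (h1 : δ ≤ 1) (c : ℝ) : ∃ T : Finset ℝ,
      (T.card : ℝ) ≤ 2 * ((1 + (1 + Real.log D) / -Real.log A) * (1 - Real.log δ)) ∧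
      ∀ a ∈ closure Ω', a ∈ Icc c (c + δ) → ∀ x ∈ range (u a),
        Disjoint (openSegment ℝ a x) Ω' → δ < |x - a| → |x - a| ≤ D → x ∈ T := by
  classical
  have hlA : 0 < -Real.log A := by linarith [Real.log_neg hA hA1]
  have hlD : 0 ≤ Real.log D := Real.log_nonneg hD
  have hlδ := one_le_one_sub_log h0 h1
  have hunique : ∀ P : ℝ → Prop, (∀ a b, P a → P b → a = b) → (∀ a, P a → a ∈ closure Ω') →
      ∃ T : Finset ℝ,
        (T.card : ℝ) ≤ (1 + (1 + Real.log D) / -Real.log A) * (1 - Real.log δ) ∧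
        ∀ a, P a → ∀ x ∈ range (u a), δ < |x - a| → |x - a| ≤ D → x ∈ T := by
    intro P hP hPc
    by_cases hex : ∃ a, P a
    · obtain ⟨a, ha⟩ := hex
      obtain ⟨T, hT, hmem⟩ := (hu a (hPc a ha)).exists_finset hA hA1 hD h0 h1
      refine ⟨T, hT, fun b hb => ?_⟩
      rw [hP b a hb ha]
      exact hmem
    · refine ⟨∅, ?_, fun a ha => absurd ⟨a, ha⟩ hex⟩
      simp only [Finset.card_empty, Nat.cast_zero]
      positivity
  -- A term farther than `δ` to the right of `a` has passed the whole interval, so disjointness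
  -- leaves only the greatest limit point; on the left, only the least.
  obtain ⟨T₁, hT₁, hmem₁⟩ := hunique (IsGreatest (closure Ω' ∩ Icc c (c + δ)))
    (fun a b ha hb => ha.unique hb) fun a ha => ha.1.1
  obtain ⟨T₂, hT₂, hmem₂⟩ := hunique (IsLeast (closure Ω' ∩ Icc c (c + δ)))
    (fun a b ha hb => ha.unique hb) fun a ha => ha.1.1
  refine ⟨T₁ ∪ T₂, ?_, fun a ha hac x hx hdisj hδ hxD => ?_⟩
  · have : ((T₁ ∪ T₂).card : ℝ) ≤ T₁.card + T₂.card := by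
      exact_mod_cast Finset.card_union_le T₁ T₂
    linarith
  rcases le_total a x with hax | hax
  · rw [abs_of_nonneg (by linarith)] at hδ
    refine Finset.mem_union_left _ (hmem₁ a ⟨⟨ha, hac⟩, ?_⟩ x hx
      (by rw [abs_of_nonneg (by linarith)]; exact hδ) hxD)
    rintro b ⟨hb, hbc⟩
    by_contra hab
    push Not at hab
    rw [openSegment_eq_Ioo (by linarith)] at hdisj
    exact Set.disjoint_left.mp (hdisj.closure_right isOpen_Ioo)
      ⟨hab, by linarith [hbc.2, hac.1]⟩ hb
  · rw [abs_of_nonpos (by linarith)] at hδ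
    refine Finset.mem_union_right _ (hmem₂ a ⟨⟨ha, hac⟩, ?_⟩ x hx
      (by rw [abs_of_nonpos (by linarith)]; exact hδ) hxD)
    rintro b ⟨hb, hbc⟩
    by_contra hab
    push Not at hab
    rw [openSegment_symm, openSegment_eq_Ioo (by linarith)] at hdisj
    exact Set.disjoint_left.mp (hdisj.closure_right isOpen_Ioo)
      ⟨by linarith [hbc.1, hac.2], hab⟩ hb

/-- A lacunary set of order `M` is covered by `O((1 - log δ) ^ M)` intervals of length `δ`. -/
theorem IsLacunaryOfOrder.hasLogCovering {A : ℝ} (hA : 0 < A) (hA1 : A < 1) {M : ℕ} {Ω : Set ℝ}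
    (h : IsLacunaryOfOrder A M Ω) : HasLogCovering M Ω := by
  classical
  induction h with
  | one a u hu hΩ => exact hu.hasLogCovering hA hA1 hΩ
  | @succ M Ω Ω' h' l r hl hr hΩ ih =>
    obtain ⟨D₀, -, hD₀⟩ := ih.exists_abs_le
    obtain ⟨D₁, hD₁, hDl⟩ := exists_abs_sub_le_of_disjoint hA hA1 hD₀ l hl
    obtain ⟨D₂, hD₂, hDr⟩ := exists_abs_sub_le_of_disjoint hA hA1 hD₀ r hr
    obtain ⟨C₀, hC₀, hcov⟩ := ih
    have hlA : 0 < -Real.log A := by linarith [Real.log_neg hA hA1]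
    set B₁ := 1 + (1 + Real.log D₁) / -Real.log A with hB₁
    set B₂ := 1 + (1 + Real.log D₂) / -Real.log A with hB₂
    have hB₁0 : 0 ≤ B₁ := by have := Real.log_nonneg hD₁; positivity
    have hB₂0 : 0 ≤ B₂ := by have := Real.log_nonneg hD₂; positivity
    refine ⟨C₀ * (3 + 2 * B₁ + 2 * B₂), by positivity, fun δ h0 h1 => ?_⟩
    obtain ⟨t, ht, htcov⟩ := hcov δ h0 h1
    have hlδ := one_le_one_sub_log h0 h1
    set ℓ := 1 - Real.log δ with hℓ
    choose T hTcard hT using exists_finset_of_interval hA hA1 l hl hD₁ h0 h1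
    choose T' hT'card hT' using exists_finset_of_interval hA hA1 r hr hD₂ h0 h1
    refine ⟨t.biUnion fun c => {c, c - δ, c + δ} ∪ (T c ∪ T' c), ?_, fun x hx => ?_⟩
    · have hpiece : ∀ c ∈ t, (({c, c - δ, c + δ} ∪ (T c ∪ T' c)).card : ℝ) ≤
          (3 + 2 * B₁ + 2 * B₂) * ℓ := by
        intro c _
        have h3 := Finset.card_union_le {c, c - δ, c + δ} (T c ∪ T' c)
        have h4 : ({c, c - δ, c + δ} : Finset ℝ).card ≤ 3 := Finset.card_le_three
        have h5 := Finset.card_union_le (T c) (T' c)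
        have h6 : (({c, c - δ, c + δ} ∪ (T c ∪ T' c)).card : ℝ) ≤
            3 + (T c).card + (T' c).card := by
          exact_mod_cast h3.trans (by omega)
        have h7 := hTcard c
        have h8 := hT'card c
        rw [← hB₁, ← hℓ] at h7
        rw [← hB₂, ← hℓ] at h8
        linarith
      calc ((t.biUnion fun c => {c, c - δ, c + δ} ∪ (T c ∪ T' c)).card : ℝ)
          ≤ ∑ c ∈ t, (({c, c - δ, c + δ} ∪ (T c ∪ T' c)).card : ℝ) := by
            exact_mod_cast Finset.card_biUnion_le
        _ ≤ t.card * ((3 + 2 * B₁ + 2 * B₂) * ℓ) := by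
            rw [← nsmul_eq_mul]
            exact Finset.sum_le_card_nsmul _ _ _ hpiece
        _ ≤ (C₀ * ℓ ^ M) * ((3 + 2 * B₁ + 2 * B₂) * ℓ) := by gcongr
        _ = _ := by ring
    · simp only [mem_iUnion, Finset.mem_biUnion, Finset.mem_union]
      rcases hΩ x hx with hx' | ⟨a, ha, hdisj, hxa⟩
      · have := htcov hx'
        simp only [mem_iUnion] at this
        obtain ⟨c, hc, hxc⟩ := this
        exact ⟨c, ⟨c, hc, by simp⟩, hxc⟩
      -- A finite union of closed intervals is closed, so the cover of `Ω'` also covers its closure.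
      · have hac : a ∈ ⋃ c ∈ t, Icc c (c + δ) := by
          have hclosed : IsClosed (⋃ c ∈ t, Icc c (c + δ)) :=
            t.finite_toSet.isClosed_biUnion fun c _ => isClosed_Icc
          exact closure_minimal htcov hclosed ha
        simp only [mem_iUnion] at hac
        obtain ⟨c, hc, hac⟩ := hac
        by_cases hxδ : |x - a| ≤ δ
        · rcases mem_cover_of_abs_sub_le hac hxδ with h2 | h2 | h2
          · exact ⟨c, ⟨c, hc, by simp⟩, h2⟩
          · exact ⟨c - δ, ⟨c, hc, by simp⟩, h2⟩
          · exact ⟨c + δ, ⟨c, hc, by simp⟩, h2⟩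
        · push Not at hxδ
          refine ⟨x, ⟨c, hc, Or.inr ?_⟩, le_rfl, by linarith⟩
          rcases hxa with hxa | hxa
          · exact Or.inl (hT c a ha hac x hxa hdisj hxδ (hDl a ha x hxa hdisj))
          · exact Or.inr (hT' c a ha hac x hxa hdisj hxδ (hDr a ha x hxa hdisj))

/-- Any exponent below one would do; it only serves to find a transversal direction. -/
theorem HasLogCovering.hasCoveringExponent {M : ℕ} (hM : 1 ≤ M) {Ω : Set ℝ}
    (h : HasLogCovering M Ω) : HasCoveringExponent Ω (1 / 2) := by
  obtain ⟨C, hC, hcov⟩ := h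
  have hM0 : (0 : ℝ) < M := by exact_mod_cast hM
  refine ⟨C * (1 + 2 * M) ^ M, by positivity, 1, one_pos, fun δ h0 h1 => ?_⟩
  obtain ⟨t, ht, htcov⟩ := hcov δ h0 h1.le
  refine ⟨t, ht.trans ?_, htcov⟩
  have hlδ := one_le_one_sub_log h0 h1.le
  have h2 := Real.log_le_rpow_div (x := δ⁻¹) (by positivity) (ε := 1 / (2 * M)) (by positivity)
  rw [Real.log_inv, div_div_eq_mul_div, div_one] at h2
  have h3 : 1 ≤ (δ⁻¹) ^ (1 / (2 * M) : ℝ) :=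
    Real.one_le_rpow ((one_le_inv₀ h0).mpr h1.le) (by positivity)
  have h4 : 1 - Real.log δ ≤ (1 + 2 * M) * (δ⁻¹) ^ (1 / (2 * M) : ℝ) := by linarith
  have h5 : ((δ⁻¹) ^ (1 / (2 * M) : ℝ)) ^ M = δ ^ (-(1 / 2) : ℝ) := by
    rw [← Real.rpow_natCast, ← Real.rpow_mul (by positivity), Real.inv_rpow h0.le,
      ← Real.rpow_neg h0.le]
    congr 1
    field_simp
  calc C * (1 - Real.log δ) ^ M ≤ C * ((1 + 2 * M) * (δ⁻¹) ^ (1 / (2 * M) : ℝ)) ^ M := by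
        gcongr
    _ = C * (1 + 2 * M) ^ M * δ ^ (-(1 / 2) : ℝ) := by rw [mul_pow, h5, mul_assoc]

/-! ### The bound for lacunary sets and the theorem -/

theorem exists_discrepancy_le_of_lacunary {Ω : Set ℝ} (k : ℕ) {M : ℕ} (hM : 1 ≤ M)
    (hΩ : IsFiniteUnionLacunary M Ω) : ∃ C > (0 : ℝ), ∀ N : ℕ, 1 ≤ N →
      discrepancy Ω k N ≤ ENNReal.ofReal (C * log' N ^ (2 * M + 1)) := by
  obtain ⟨S, hS, rfl, hlac⟩ := hΩ
  have hlog : HasLogCovering M (⋃₀ S) := by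
    refine HasLogCovering.sUnion hS fun T hT => ?_
    obtain ⟨m, A, -, hmM, hA, hA1, h⟩ := hlac T hT
    exact (h.hasLogCovering hA hA1).mono hmM
  obtain ⟨C, hC1, hdisc⟩ := exists_discrepancy_le_of_covering (hlog.hasCoveringExponent hM)
    (by norm_num) k
  obtain ⟨C₁, hC₁, hcov⟩ := hlog
  set C₂ := C * (C₁ * 2 ^ M + 1) with hC₂
  have hC₂1 : 1 ≤ C₂ := by
    have : 0 ≤ C₁ * 2 ^ M := by positivity
    nlinarith
  refine ⟨C * C₂, by positivity, fun N hN => ?_⟩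
  have hN1 : (1 : ℝ) ≤ N := by exact_mod_cast hN
  have hN0 : (0 : ℝ) < N := by linarith
  have hL := one_le_log' N
  obtain ⟨t, ht, htcov⟩ := hcov ((N : ℝ)⁻¹) (by positivity) (inv_le_one_of_one_le₀ hN1)
  have hlogN : Real.log N ≤ log' N := by
    refine le_trans ?_ (log_le_log' N)
    rw [Real.logb, le_div_iff₀ (Real.log_pos (by norm_num))]
    have h1 := Real.log_two_lt_d9
    have h2 := Real.log_nonneg hN1
    nlinarith
  have htcard : (t.card : ℝ) + 1 ≤ (C₁ * 2 ^ M + 1) * log' N ^ M := by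
    rw [Real.log_inv, sub_neg_eq_add] at ht
    have h1 : (1 + Real.log N) ^ M ≤ (2 * log' N) ^ M := by
      have := Real.log_nonneg hN1
      gcongr
      linarith
    have h2 : 1 ≤ log' N ^ M := one_le_pow₀ hL
    calc (t.card : ℝ) + 1 ≤ C₁ * (2 * log' N) ^ M + log' N ^ M := by
          gcongr
          exact ht.trans (by gcongr)
      _ = _ := by rw [mul_pow]; ring
  refine (hdisc N hN (C₂ * log' N ^ (M + 1)) (N : ℝ)⁻¹ t (by positivity) htcov ?_ ?_).trans
    (ENNReal.ofReal_le_ofReal ?_)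
  · rw [inv_mul_cancel₀ hN0.ne']
    have : 1 ≤ log' N ^ (M + 1) := one_le_pow₀ hL
    nlinarith
  · calc C * (t.card + 1) * log' N ≤ C * ((C₁ * 2 ^ M + 1) * log' N ^ M) * log' N := by gcongr
      _ = C₂ * log' N ^ (M + 1) := by rw [hC₂]; ring
  · calc C * (C₂ * log' N ^ (M + 1)) * log' N = C * C₂ * log' N ^ (M + 2) := by ring
      _ ≤ C * C₂ * log' N ^ (2 * M + 1) := by
          -- The method yields the exponent `M + 2`; this is where `M ≥ 1` is needed to reach `2 * M
          -- + 1`.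
          have := pow_le_pow_right₀ hL (show M + 2 ≤ 2 * M + 1 by omega)
          gcongr

end DirectionalDiscrepancy

theorem theorem3 (Ω : Set ℝ) (k : ℕ) :
    (∀ M : ℕ, 1 ≤ M → DirectionalDiscrepancy.IsFiniteUnionLacunary M Ω →
      ∃ C > (0 : ℝ), ∀ N : ℕ, 1 ≤ N →
        DirectionalDiscrepancy.discrepancy Ω k N ≤
          ENNReal.ofReal (C * DirectionalDiscrepancy.log' N ^ (2 * M + 1))) ∧
    (∀ d τ : ℝ, DirectionalDiscrepancy.HasUpperMinkowskiDim Ω d → d < 1 →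
      τ = 2 / (1 - d) ^ 2 - 2 → ∀ ε > (0 : ℝ),
      ∃ C > (0 : ℝ), ∀ N : ℕ, 1 ≤ N →
        DirectionalDiscrepancy.discrepancy Ω k N ≤
          ENNReal.ofReal (C * (N : ℝ) ^ (τ / (2 * (τ + 1)) + ε))) := by
  refine ⟨fun M hM hΩ => ?_, fun d τ hdim hd hτ ε hε => ?_⟩
  · exact DirectionalDiscrepancy.exists_discrepancy_le_of_lacunary k hM hΩ
  · exact DirectionalDiscrepancy.exists_discrepancy_le_of_dim k hdim hd hτ hε
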